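/- **Setting.** Let $d\ge 2$, $\lambda\ge 1$, $\alpha>0$, $\kappa\ge 1$, $0<c\le 1/2$, $n\in\mathbb N^*$ and $0<\delta<1$. Write $\lceil\alpha\rceil$ for the least integer $\ge\alpha$, $\lfloor\alpha\rfloor$ for the largest integer *strictly* smaller than $\alpha$, and $m=\max(1,\lfloor\alpha\rfloor)$. Points of $[0,1]^d$ are written $x=(\tilde x,x_d)\in[0,1]^{d-1}\times[0,1]$. *Problem class.* $\Sigma(\lambda,\alpha)$ is the set of $\lfloor\alpha\rfloor$ times continuously differentiable $g:[0,1]^{d-1}\to[0,1]$ such that $|g(x)-\mathrm{TP}_{y,\lfloor\beta\rfloor}(x)|\le\lambda\|x-y\|_\infty^\beta$ for all $x,y\in[0,1]^{d-1}$ and all $0<\beta\le\alpha$, where $\mathrm{TP}_{y,k}$ is the Taylor polynomial of $g$ of degree $k$ at $y$. A classification problem on $[0,1]^d$ with labels in $\{0,1\}$ and regression function $\eta(x)=\mathbb P(Y=1\mid X=x)$ belongs to $\mathcal P(\alpha,\kappa)=\mathcal P(\lambda,\alpha,\kappa,c)$ if there is $g^*\in\Sigma(\lambda,\alpha)$ with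 $\{x:\eta(x)\ge 1/2\}=\{x:x_d\ge g^*(\tilde x)\}$ and $|\eta(x)-\tfrac12|\ge c\,|x_d-g^*(\tilde x)|^{\kappa-1}$ for all $x\in[0,1]^d$. A learner may request labels at points of its choice; each requested label at $x$ is a fresh Bernoulli$(\eta(x))$ variable, independent of the other labels. *Line search* with precision $\epsilon$ and confidence $\delta'$ along $\{\tilde x\}\times[0,1]$: put $K=\max(0,\lceil\log_2\frac1{2\epsilon}\rceil)$ and $[L_1,R_1]=[0,1]$. For $k=1,\dots,K$, let $U_k,M_k,V_k$ be the quartiles of $[L_k,R_k]$ in increasing order and $\delta_k=\delta'/(K2^k)$. In rounds $t=1,2,\dots$ request one label at each of $(\tilde x,U_k),(\tilde x,M_k),(\tilde x,V_k)$; let $\hat\eta_t(Z)$ be the mean of the $t$ labels received at $(\tilde x,Z)$ in this epoch and $w_t=2\sqrt{\log(t/\delta_k)/(2t)}$. The epoch ends at the first $t$ with $|\hat\eta_t(M_k)-\frac12|\ge w_t$, in which case $[L_{k+1},R_{k+1}]$ is $[L_k,M_k]$ if $\hat\eta_t(M_k)>\frac12$ and $[M_k,R_k]$ otherwise; or with $\hat\eta_t(V_k)-\frac12\ge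 w_t$ and $\frac12-\hat\eta_t(U_k)\ge w_t$, in which case (if the first condition fails) $[L_{k+1},R_{k+1}]=[U_k,V_k]$. The output is the midpoint $T$ of the last interval. *Algorithm 2* with inputs $n,\delta,\lambda,\alpha$: for $l=1,2,\dots$, as long as the budget of $n$ labels is not exhausted, put $M_l=m2^l$, $\epsilon_l=\lambda2^{-l\alpha}$, $\delta_l=\delta/(m2^{l(d+1)})$, and for each $\tilde a\in\{0,\dots,M_l\}^{d-1}$ run the line search with parameters $\epsilon_l,\delta_l$ along $\{M_l^{-1}\tilde a\}\times[0,1]$, giving $T_{l,\tilde a}$. The run is interrupted when the budget is exhausted; $l^*$ is the last depth at which all line searches were completed. If no depth was completed, output $S^0=S^1=\emptyset$. Otherwise split $[0,1]^{d-1}$ into the $2^{l^*(d-1)}$ cells of side $2^{-l^*}$, and let $\widehat P$ be, on the cell with lower corner $2^{-l^*}\tilde q$, the tensor-product Lagrange polynomial of degree $\lfloor\alpha\rfloor$ in each variable with the values $T_{l^*,\tilde a}$ at the nodes $M_{l^*}^{-1}\tilde a$, $\tilde a\in m\tilde q+\{0,\dots,\lfloor\alpha\rfloor\}^{d-1}$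 (for $\alpha\le 1$: the constant $T_{l^*,\tilde q}$). With $b=\lambda\lceil\alpha\rceil^{d\lceil\alpha\rceil}M_{l^*}^{-\alpha}$, output $S^0=\{x\in[0,1]^d:x_d\le\widehat P(\tilde x)-4b\}$ and $S^1=\{x\in[0,1]^d:x_d\ge\widehat P(\tilde x)+4b\}$. (The parameters $\kappa$ and $c$ are not used.) *Correctness.* For $\Delta\ge 0$, a procedure that returns disjoint measurable sets $S^0,S^1\subset[0,1]^d$ is $(\delta,\Delta,n)$-correct if, with probability larger than $1-2\delta$, it makes at most $n$ label requests and $$\{x_d-g^*(\tilde x)>\Delta\}\subset S^1\subset\{x_d>g^*(\tilde x)\},\qquad \{g^*(\tilde x)-x_d>\Delta\}\subset S^0\subset\{x_d<g^*(\tilde x)\}.$$ **Theorem.** Algorithm 2, run with parameters $n,\delta,\lambda,\alpha$ on any problem in $\mathcal P(\lambda,\alpha,\kappa,c)$, is $(\delta,\Delta_n,n)$-correct for some $\Delta_n\ge 0$ which, if $\kappa>1$, satisfies $$\Delta_n\le 7\lceil\alpha\rceil^{d\lceil\alpha\rceil}\,2^\alpha\,\lambda^{\frac{d-1}{2\alpha(\kappa-1)+d-1}}\Big(\frac{\log(n/\delta)}{c_1n}\Big)^{\frac{\alpha}{2\alpha(\kappa-1)+d-1}},\qquad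 c_1=\frac{(\kappa-1)c^2}{400\,(2\lceil\alpha\rceil)^{d-1}\,\alpha\,\log(1/c)\,\kappa\,8^{2(\kappa-1)}}.$$ (For $\kappa=1$ one has $c_1=0$ and the bound is void.) -/

import Mathlib

open MeasureTheory ProbabilityTheory

noncomputable section

namespace ActiveLearning

/-- The largest integer strictly smaller than `a` (for `0 < a`). -/
def strictFloor (a : ℝ) : ℕ := ⌈a⌉₊ - 1

/-- The unit cube `[0,1]^(d-1)`; the norm on `Fin (d - 1) → ℝ` is the sup norm. -/
def baseCube (d : ℕ) : Set (Fin (d - 1) → ℝ) := Set.Icc 0 1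

/-- Points `x = (x̃, x_d)` of `ℝ^(d-1) × ℝ`. -/
abbrev Point (d : ℕ) : Type := (Fin (d - 1) → ℝ) × ℝ

/-- The feature space `[0,1]^d = [0,1]^(d-1) × [0,1]`. -/
def cube (d : ℕ) : Set (Point d) := baseCube d ×ˢ Set.Icc (0 : ℝ) 1

/-! ### The nonparametric class -/

/-- Taylor polynomial of degree `k` of `g` at `y`, evaluated at `x`. -/
def taylorPoly {d : ℕ} (g : (Fin (d - 1) → ℝ) → ℝ) (k : ℕ) (y x : Fin (d - 1) → ℝ) : ℝ :=
  ∑ j ∈ Finset.range (k + 1),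
    (1 / (j.factorial : ℝ)) * iteratedFDerivWithin ℝ j g (baseCube d) y (fun _ => x - y)

/-- The Hölder class `Σ(lam, α)` of functions `[0,1]^(d-1) → [0,1]`. -/
structure HolderClass (d : ℕ) (lam α : ℝ) (g : (Fin (d - 1) → ℝ) → ℝ) : Prop where
  mapsTo : Set.MapsTo g (baseCube d) (Set.Icc 0 1)
  contDiffOn : ContDiffOn ℝ (strictFloor α) g (baseCube d)
  taylor : ∀ β : ℝ, 0 < β → β ≤ α → ∀ x ∈ baseCube d, ∀ y ∈ baseCube d,
    |g x - taylorPoly g (strictFloor β) y x| ≤ lam * ‖x - y‖ ^ β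

/-- A binary classification problem on `[0,1]^d`, given by the marginal law of `X` and the
regression function `η(x) = P(Y = 1 | X = x)`. -/
structure ClassificationProblem (d : ℕ) where
  marginal : Measure (Point d)
  isProbabilityMeasure : IsProbabilityMeasure marginal
  support : marginal (cube d)ᶜ = 0
  eta : Point d → ℝ
  measurable_eta : Measurable eta
  eta_mem : ∀ x ∈ cube d, eta x ∈ Set.Icc (0 : ℝ) 1

/-- The problem belongs to the class `𝒫(lam, α, κ, c)`, with decision boundary (the graph of)
`g`: the set `{η ≥ 1/2}` is the epigraph of `g ∈ Σ(lam, α)`, and the geometric noise condition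
holds with constants `κ` and `c`. -/
structure InClass {d : ℕ} (P : ClassificationProblem d) (lam α κ c : ℝ)
    (g : (Fin (d - 1) → ℝ) → ℝ) : Prop where
  holder : HolderClass d lam α g
  epigraph : {x ∈ cube d | 1 / 2 ≤ P.eta x} = {x ∈ cube d | g x.1 ≤ x.2}
  noise : ∀ x ∈ cube d, c * |x.2 - g x.1| ^ (κ - 1) ≤ |P.eta x - 1 / 2|

/-! ### Label requests -/

/-- The address of a label request in a run of the algorithm: depth of the grid, line of that
grid, epoch of the line search, which of the three points `U, M, V` of the epoch
(`0`, `1`, `2` in this order), and round of the epoch. In a run every address is used at most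
once, so each request gets a fresh label. -/
structure Request (d : ℕ) where
  depth : ℕ
  line : Fin (d - 1) → ℕ
  epoch : ℕ
  point : Fin 3
  round : ℕ

/-- Label oracle: `Y r x` is the label revealed if request `r` is made at the point `x`. It is
`1` (`true`) with probability `η(x)`, and the answers to distinct requests are independent. -/
structure IsLabelOracle {d : ℕ} {Ω : Type*} [MeasurableSpace Ω] (P : ClassificationProblem d)
    (μ : Measure Ω) (Y : Request d → Point d → Ω → Bool) : Prop where
  measurable : ∀ r x, Measurable (Y r x)
  law : ∀ r, ∀ x ∈ cube d, μ {ω | Y r x ω = true} = ENNReal.ofReal (P.eta x)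
  indep : iIndepFun (fun r ω x => Y r x ω) μ

/-! ### The line search

A run of a procedure with a budget of `B` labels returns the number of labels it requested,
together with its result, or `none` if the budget ran out before it terminated. -/

/-- Confidence term `2 √(log (t / δ) / (2 t))`. -/
def conf (δ : ℝ) (t : ℕ) : ℝ := 2 * Real.sqrt (Real.log (t / δ) / (2 * t))

/-- Empirical mean of the first `t` labels. -/
def empMean (y : ℕ → Bool) (t : ℕ) : ℝ :=
  (∑ i ∈ Finset.range t, if y i then (1 : ℝ) else 0) / t

/-- The middle point is confidently labelled after `t` rounds. -/
def MidDecided (yM : ℕ → Bool) (δ : ℝ) (t : ℕ) : Prop :=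
  conf δ t ≤ |empMean yM t - 1 / 2|

/-- Both outer points are confidently labelled after `t` rounds, `V` by `1` and `U` by `0`. -/
def OuterDecided (yU yV : ℕ → Bool) (δ : ℝ) (t : ℕ) : Prop :=
  conf δ t ≤ empMean yV t - 1 / 2 ∧ conf δ t ≤ 1 / 2 - empMean yU t

open Classical in
/-- One epoch on the interval `[I.1, I.2]`. Each round requests three labels, one at each
quartile; `y j i z` is the answer in round `i` at the `j`-th of the points `U, M, V`, which is
`z`. The result is the next interval. -/
def epochRun (y : Fin 3 → ℕ → ℝ → Bool) (δ : ℝ) (I : ℝ × ℝ) (B : ℕ) : ℕ × Option (ℝ × ℝ) :=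
  let M := (I.1 + I.2) / 2
  let U := (I.2 - I.1) / 4 + I.1
  let V := (I.2 - I.1) / 4 + M
  let yU := fun i => y 0 i U
  let yM := fun i => y 1 i M
  let yV := fun i => y 2 i V
  if h : ∃ t, 1 ≤ t ∧ 3 * t ≤ B ∧ (MidDecided yM δ t ∨ OuterDecided yU yV δ t) then
    let t := Nat.find h
    (3 * t, some (if MidDecided yM δ t then
        (if 1 / 2 < empMean yM t then (I.1, M) else (M, I.2))
      else (U, V)))
  else (3 * (B / 3), none)

/-- The first `k` epochs of the line search on `[0,1]`; epoch `k` has confidence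
parameter `δ / (K 2^k)`. -/
def epochs (y : ℕ → Fin 3 → ℕ → ℝ → Bool) (δ : ℝ) (K B : ℕ) : ℕ → ℕ × Option (ℝ × ℝ)
  | 0 => (0, some (0, 1))
  | k + 1 =>
    match epochs y δ K B k with
    | (N, none) => (N, none)
    | (N, some I) =>
      let r := epochRun (y (k + 1)) (δ / (K * 2 ^ (k + 1))) I (B - N)
      (N + r.1, r.2)

/-- Number of epochs `⌈log₂ (1 / (2 ε))⌉` (none if this is not positive). -/
def numEpochs (ε : ℝ) : ℕ := ⌈Real.logb 2 (1 / (2 * ε))⌉₊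

/-- The line search with precision `ε` and confidence `δ`; the result is the threshold estimate,
the midpoint of the final interval. -/
def lineSearch (y : ℕ → Fin 3 → ℕ → ℝ → Bool) (ε δ : ℝ) (B : ℕ) : ℕ × Option ℝ :=
  let r := epochs y δ (numEpochs ε) B (numEpochs ε)
  (r.1, r.2.map fun I => (I.1 + I.2) / 2)

/-! ### The `κ`-adaptive procedure in dimension `d` -/

/-- `max(1, ⌊α⌋)`, with `⌊α⌋` the largest integer strictly smaller than `α`. -/
def cellNodes (α : ℝ) : ℕ := max 1 (strictFloor α)

/-- Number of grid steps per axis at depth `l`. -/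
def gridSize (α : ℝ) (l : ℕ) : ℕ := cellNodes α * 2 ^ l

/-- Precision of the line searches at depth `l`. -/
def precision (lam α : ℝ) (l : ℕ) : ℝ := lam * (2 : ℝ) ^ (-(l * α))

/-- Confidence parameter of the line searches at depth `l`. -/
def depthConf (d : ℕ) (δ α : ℝ) (l : ℕ) : ℝ := δ / (cellNodes α * 2 ^ (l * (d + 1)))

/-- Grid point `M_l⁻¹ a`. -/
def gridPoint {d : ℕ} (α : ℝ) (l : ℕ) (a : Fin (d - 1) → ℕ) : Fin (d - 1) → ℝ :=
  fun i => (a i : ℝ) / gridSize α l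

/-- Indices `{0, …, M_l}^(d-1)` of the lines at depth `l`. -/
def lineIndices (d : ℕ) (α : ℝ) (l : ℕ) : Finset (Fin (d - 1) → ℕ) :=
  Fintype.piFinset fun _ => Finset.range (gridSize α l + 1)

/-- Line search along `{M_l⁻¹ a} × [0,1]`, when the oracle answers are `y`. -/
def searchLine {d : ℕ} (y : Request d → Point d → Bool) (δ lam α : ℝ) (l : ℕ)
    (a : Fin (d - 1) → ℕ) (B : ℕ) : ℕ × Option ℝ :=
  lineSearch (fun k j i z => y ⟨l, a, k, j, i⟩ (gridPoint α l a, z))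
    (precision lam α l) (depthConf d δ α l) B

/-- Line searches along a list of lines, one after the other with the common budget `B`; the
result is the map from lines to threshold estimates. -/
def searchLines {d : ℕ} (y : Request d → Point d → Bool) (δ lam α : ℝ) (l B : ℕ) :
    List (Fin (d - 1) → ℕ) → ℕ × Option ((Fin (d - 1) → ℕ) → ℝ)
  | [] => (0, some 0)
  | a :: as =>
    match searchLines y δ lam α l B as with
    | (N, none) => (N, none)
    | (N, some T) =>
      let r := searchLine y δ lam α l a (B - N)
      (N + r.1, r.2.map fun τ => Function.update T a τ)

/-- State after passes `1, …, l` of the main loop with budget `n`: the number of labels requested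
so far, and the threshold estimates at depth `l` if that depth was completed. -/
def mainLoop {d : ℕ} (y : Request d → Point d → Bool) (n : ℕ) (δ lam α : ℝ) :
    ℕ → ℕ × Option ((Fin (d - 1) → ℕ) → ℝ)
  | 0 => (0, some 0)
  | l + 1 =>
    match mainLoop y n δ lam α l with
    | (t, none) => (t, none)
    | (t, some _) =>
      if t < n then
        let r := searchLines y δ lam α (l + 1) (n - t) (lineIndices d α (l + 1)).toList
        (t + r.1, r.2)
      else (t, none)

/-- The last completed depth `l*` (`0` if not even depth `1` was completed). The completed depths
form an initial segment, which is finite because deep searches cost labels. -/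
def finalDepth {d : ℕ} (y : Request d → Point d → Bool) (n : ℕ) (δ lam α : ℝ) : ℕ :=
  sSup {l | (mainLoop y n δ lam α l).2.isSome}

/-- Total number of labels requested, including those of the depth that was not completed. -/
def labelsRequested {d : ℕ} (y : Request d → Point d → Bool) (n : ℕ) (δ lam α : ℝ) : ℕ :=
  (mainLoop y n δ lam α (finalDepth y n δ lam α + 1)).1

/-- Threshold estimates at the last completed depth. -/
def thresholds {d : ℕ} (y : Request d → Point d → Bool) (n : ℕ) (δ lam α : ℝ) :
    (Fin (d - 1) → ℕ) → ℝ :=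
  ((mainLoop y n δ lam α (finalDepth y n δ lam α)).2).getD 0

/-- Index `q ∈ {0, …, 2^l - 1}^(d-1)` of the cell of side `2^(-l) = max(1,⌊α⌋) / M_l` that
contains `x`. -/
def cellIndex {d : ℕ} (l : ℕ) (x : Fin (d - 1) → ℝ) : Fin (d - 1) → ℕ :=
  fun i => min ⌊x i * 2 ^ l⌋₊ (2 ^ l - 1)

/-- Tensor-product Lagrange polynomial, in the cell `q`, of the node `a = max(1,⌊α⌋) q + j`, where
`j ∈ {0, …, ⌊α⌋}^(d-1)`. -/
def lagrangeBasis {d : ℕ} (α : ℝ) (l : ℕ) (q j : Fin (d - 1) → ℕ) (x : Fin (d - 1) → ℝ) : ℝ :=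
  ∏ i, ∏ j' ∈ (Finset.range (strictFloor α + 1)).erase (j i),
    (x i - ((cellNodes α * q i + j' : ℕ) : ℝ) / gridSize α l) /
      (((cellNodes α * q i + j i : ℕ) : ℝ) / gridSize α l -
        ((cellNodes α * q i + j' : ℕ) : ℝ) / gridSize α l)

/-- Piecewise tensor-product Lagrange interpolation of degree `⌊α⌋` of the thresholds `T` at depth
`l`. For `α ≤ 1` it is constant on each cell, with the value at the lower corner. -/
def interpolant {d : ℕ} (α : ℝ) (l : ℕ) (T : (Fin (d - 1) → ℕ) → ℝ) (x : Fin (d - 1) → ℝ) : ℝ :=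
  ∑ j ∈ Fintype.piFinset (fun _ : Fin (d - 1) => Finset.range (strictFloor α + 1)),
    T (fun i => cellNodes α * cellIndex l x i + j i) * lagrangeBasis α l (cellIndex l x) j x

/-- Bias term `b_l`. -/
def bias (d : ℕ) (lam α : ℝ) (l : ℕ) : ℝ :=
  lam * (⌈α⌉₊ : ℝ) ^ (d * ⌈α⌉₊) * (gridSize α l : ℝ) ^ (-α)

/-- The set labelled `0` by the algorithm; everything is left unlabelled if no depth was
completed. -/
def outputZero {d : ℕ} (y : Request d → Point d → Bool) (n : ℕ) (δ lam α : ℝ) :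
    Set (Point d) :=
  let l := finalDepth y n δ lam α
  {x ∈ cube d | 1 ≤ l ∧
    x.2 ≤ interpolant α l (thresholds y n δ lam α) x.1 - 4 * bias d lam α l}

/-- The set labelled `1` by the algorithm. -/
def outputOne {d : ℕ} (y : Request d → Point d → Bool) (n : ℕ) (δ lam α : ℝ) :
    Set (Point d) :=
  let l := finalDepth y n δ lam α
  {x ∈ cube d | 1 ≤ l ∧
    interpolant α l (thresholds y n δ lam α) x.1 + 4 * bias d lam α l ≤ x.2}

/-! ### Correctness -/

/-- A procedure with random outputs `S₀`, `S₁`, which makes `N` label requests, is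
`(δ, Δ, n)`-correct for a problem with decision boundary `g`: its outputs are disjoint measurable
subsets of the cube and, with probability larger than `1 - 2 δ`, it makes at most `n` requests,
labels every point at vertical distance more than `Δ` from the boundary, and makes no mistake. -/
structure IsCorrect {d : ℕ} {Ω : Type*} [MeasurableSpace Ω] (μ : Measure Ω)
    (S₀ S₁ : Ω → Set (Point d)) (N : Ω → ℕ) (g : (Fin (d - 1) → ℝ) → ℝ)
    (δ Δ : ℝ) (n : ℕ) : Prop where
  nonneg : 0 ≤ Δ
  subset_zero : ∀ ω, S₀ ω ⊆ cube d
  subset_one : ∀ ω, S₁ ω ⊆ cube d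
  disjoint : ∀ ω, Disjoint (S₀ ω) (S₁ ω)
  measurable_zero : ∀ ω, MeasurableSet (S₀ ω)
  measurable_one : ∀ ω, MeasurableSet (S₁ ω)
  prob : μ {ω | ¬ (N ω ≤ n ∧
      {x ∈ cube d | Δ < x.2 - g x.1} ⊆ S₁ ω ∧
      {x ∈ cube d | Δ < g x.1 - x.2} ⊆ S₀ ω ∧
      S₁ ω ⊆ {x ∈ cube d | g x.1 < x.2} ∧
      S₀ ω ⊆ {x ∈ cube d | x.2 < g x.1})} < ENNReal.ofReal (2 * δ)

/-- The constant `c₁`. -/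
def c₁ (d : ℕ) (α κ c : ℝ) : ℝ :=
  (κ - 1) * c ^ 2 /
    (400 * (2 * (⌈α⌉₊ : ℝ)) ^ (d - 1) * α * Real.log (1 / c) * κ * (8 : ℝ) ^ (2 * (κ - 1)))

/-- The bound on the half-width `Δ_n` of the abstention region. -/
def widthBound (d n : ℕ) (δ lam α κ c : ℝ) : ℝ :=
  7 * (⌈α⌉₊ : ℝ) ^ (d * ⌈α⌉₊) * (2 : ℝ) ^ α *
    lam ^ (((d : ℝ) - 1) / (2 * α * (κ - 1) + d - 1)) *
    (Real.log (n / δ) / (c₁ d α κ c * n)) ^ (α / (2 * α * (κ - 1) + d - 1))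

end ActiveLearning

end

open ActiveLearning

/-! Accuracy. If all empirical means of a line search are within the confidence term, a confidently
labelled quartile lies on the side of the boundary that its label indicates. Hence `g*` stays in the
current interval, and the output is within `ε_l` of it. Tensor Lagrange interpolation reproduces the
Taylor polynomial of `g*` centred at the evaluation point, whose value there is `g*` itself. Its
Lebesgue constant is at most `2 ^ (⌊α⌋ (d - 1))`. Search error and Taylor remainder together
therefore give `|P̂ - g*| ≤ 2 b` (`abs_interpolant_sub_le`, `lebesgue_mul_precision_le_bias`). With
the margin `4 b` no point is mislabelled, and every point at vertical distance more than `6 b` is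
labelled.

Probability. The query points are adaptive, but only `3 ^ k` intervals can occur after `k` epochs,
so Hoeffding's inequality is applied at all of their quartiles. The confidence term fails in round
`t` with probability at most `2 (δ / t) ^ 4`. The fourth power pays for the intervals and for the
lines, and the total is at most `δ` (`measure_not_lineDeviation_le`, `measure_not_allDeviation_le`).
At depths with `2 ^ (l + 1) ≤ ⌈α⌉` it need not pay for the lines, so there the deviation bounds are
taken at a smaller confidence parameter. This still controls cost. Accuracy is not needed there: `b`
exceeds the Lebesgue constant, so `|P̂| ≤ b` and no label can be wrong (`lebesgue_le_bias`).

Cost. In epoch `k`, either the middle point or both outer quartiles are at distance at least `2 ^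
(-k) / 8` from the boundary. The noise condition then ends the epoch after about `log / margin ^ 2`
rounds (`epochRun_terminates`). The costs form geometric sums over epochs and depths, of total order
`2 ^ (l (2 α (κ - 1) + d - 1)) λ ^ (-2 (κ - 1))` times a logarithm. If `6 b` at the last completed
depth `F` exceeded the width bound, depths `1, …, F + 1` would together cost less than `n`, and `F +
1` would be completed too (`totalCost_lt`, `six_mul_bias_le_widthBound`).

If `κ = 1` or the width bound is at least `1`, then `Δ = 1` serves, since no point is that far from
the boundary. -/

namespace ActiveLearning

/-! ### Lagrange interpolation at equispaced nodes -/

/-- The `j`-th Lagrange basis polynomial of the nodes `0, …, r`, evaluated at `u`. -/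
noncomputable def natLagrange (r j : ℕ) (u : ℝ) : ℝ :=
  ∏ j' ∈ (Finset.range (r + 1)).erase j, (u - j') / ((j : ℝ) - j')

/-- Interpolation at `r + 1` nodes reproduces `(X - u) ^ k`; the identity is this reproduction
evaluated at `u`. -/
theorem sum_natLagrange_mul_pow (r k : ℕ) (hk : k ≤ r) (u : ℝ) :
    ∑ j ∈ Finset.range (r + 1), natLagrange r j u * ((j : ℝ) - u) ^ k = 0 ^ k := by
  have hinj : Set.InjOn (fun j : ℕ => (j : ℝ)) (Finset.range (r + 1)) :=
    fun a _ b _ h => Nat.cast_injective h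
  have hdeg : ((Polynomial.X - Polynomial.C u) ^ k : Polynomial ℝ).degree
      < (Finset.range (r + 1)).card := by
    rw [Polynomial.degree_pow, Polynomial.degree_X_sub_C, Finset.card_range]
    simp only [nsmul_eq_mul, mul_one]
    exact_mod_cast Nat.lt_succ_of_le hk
  have h := congrArg (Polynomial.eval u) (Lagrange.eq_interpolate hinj hdeg)
  rw [Lagrange.interpolate_apply, Polynomial.eval_finsetSum] at h
  simp only [Polynomial.eval_pow, Polynomial.eval_sub, Polynomial.eval_X, Polynomial.eval_C,
    sub_self, Polynomial.eval_mul] at h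
  rw [h]
  refine Finset.sum_congr rfl fun j _ => ?_
  rw [mul_comm]
  congr 1
  simp only [natLagrange, Lagrange.basis, Lagrange.basisDivisor, Polynomial.eval_prod,
    Polynomial.eval_mul, Polynomial.eval_C, Polynomial.eval_sub, Polynomial.eval_X]
  refine Finset.prod_congr rfl fun _ _ => ?_
  rw [div_eq_inv_mul]

theorem prod_range_add_one_sub (r : ℕ) :
    ∏ j ∈ Finset.range (r + 1), ((r : ℝ) + 1 - j) = ((r + 1).factorial : ℝ) := by
  induction r with
  | zero => simp
  | succ r ih =>
    rw [Finset.prod_range_succ']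
    rw [Nat.factorial_succ, Nat.cast_mul, ← ih]
    push_cast
    rw [mul_comm]
    congr 1
    · ring
    · exact Finset.prod_congr rfl fun _ _ => by ring

/-- For `u ∈ [0, r]` the product of the distances to all but one of `0, …, r` is at most `r!`. -/
theorem prod_abs_sub_le_factorial (r : ℕ) : ∀ (j : ℕ), j ≤ r → ∀ u : ℝ, 0 ≤ u → u ≤ r →
    ∏ j' ∈ (Finset.range (r + 1)).erase j, |u - j'| ≤ (r.factorial : ℝ) := by
  induction r with
  | zero =>
    intro j hj u _ _
    obtain rfl : j = 0 := by omega
    simp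
  | succ r ih =>
    intro j hj u hu hur
    push_cast at hur
    -- For `u ≤ r`, one factor at most `r + 1` is split off and the rest is the case `r`. For `u` in
    -- `(r, r + 1]`, the node `r + 1` contributes at most `1`, and the other distances are at most
    -- `r + 1, …, 1`.
    by_cases hle : u ≤ r
    · rcases Nat.lt_or_ge r j with hlt | hjr
      · obtain rfl : j = r + 1 := by omega
        have h1 : (Finset.range (r + 1 + 1)).erase (r + 1) = Finset.range (r + 1) := by
          ext x; simp only [Finset.mem_erase, Finset.mem_range]; omega
        rw [h1, ← Finset.mul_prod_erase _ _ (Finset.mem_range.2 (Nat.succ_pos r))]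
        have h2 := ih 0 (Nat.zero_le _) u hu hle
        rw [Nat.factorial_succ, Nat.cast_mul]
        refine mul_le_mul ?_ h2 (Finset.prod_nonneg fun _ _ => abs_nonneg _) (by positivity)
        rw [Nat.cast_zero, sub_zero, abs_of_nonneg hu]
        push_cast; linarith
      · have h1 : (Finset.range (r + 1 + 1)).erase j
            = insert (r + 1) ((Finset.range (r + 1)).erase j) := by
          ext x; simp only [Finset.mem_erase, Finset.mem_range, Finset.mem_insert]; omega
        rw [h1, Finset.prod_insert (by simp)]
        rw [Nat.factorial_succ, Nat.cast_mul]
        refine mul_le_mul ?_ (ih j hjr u hu hle) (Finset.prod_nonneg fun _ _ => abs_nonneg _)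
          (by positivity)
        push_cast
        rw [abs_le]; constructor <;> linarith
    · push Not at hle
      have hb : ∀ j' ∈ Finset.range (r + 1), |u - j'| ≤ (r : ℝ) + 1 - j' := by
        intro j' hj'
        have : (j' : ℝ) ≤ r := by exact_mod_cast Nat.lt_succ_iff.1 (Finset.mem_range.1 hj')
        rw [abs_of_nonneg (by linarith)]; linarith
      have hone : ∀ j' ∈ Finset.range (r + 1), (1 : ℝ) ≤ (r : ℝ) + 1 - j' := by
        intro j' hj'
        have : (j' : ℝ) ≤ r := by exact_mod_cast Nat.lt_succ_iff.1 (Finset.mem_range.1 hj')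
        linarith
      have hlast : |u - ((r + 1 : ℕ) : ℝ)| ≤ 1 := by
        push_cast; rw [abs_le]; constructor <;> linarith
      have hsub : ∏ j' ∈ (Finset.range (r + 1)).erase j, |u - j'| ≤ ((r + 1).factorial : ℝ) := by
        calc ∏ j' ∈ (Finset.range (r + 1)).erase j, |u - j'|
            ≤ ∏ j' ∈ (Finset.range (r + 1)).erase j, ((r : ℝ) + 1 - j') :=
              Finset.prod_le_prod (fun _ _ => abs_nonneg _)
                fun j' hj' => hb j' (Finset.mem_of_mem_erase hj')
          _ ≤ ∏ j' ∈ Finset.range (r + 1), ((r : ℝ) + 1 - j') := by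
              by_cases hjm : j ∈ Finset.range (r + 1)
              · rw [← Finset.mul_prod_erase _ _ hjm]
                refine le_mul_of_one_le_left (Finset.prod_nonneg fun j' hj' => ?_) (hone j hjm)
                linarith [hone j' (Finset.mem_of_mem_erase hj')]
              · rw [Finset.erase_eq_of_notMem hjm]
          _ = _ := prod_range_add_one_sub r
      rcases Nat.lt_or_ge r j with hlt | hjr
      · obtain rfl : j = r + 1 := by omega
        have h1 : (Finset.range (r + 1 + 1)).erase (r + 1) = (Finset.range (r + 1)).erase (r + 1) := by
          ext x; simp only [Finset.mem_erase, Finset.mem_range]; omega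
        rw [h1]; exact hsub
      · have h1 : (Finset.range (r + 1 + 1)).erase j
            = insert (r + 1) ((Finset.range (r + 1)).erase j) := by
          ext x; simp only [Finset.mem_erase, Finset.mem_range, Finset.mem_insert]; omega
        rw [h1, Finset.prod_insert (by simp)]
        refine (mul_le_of_le_one_left (Finset.prod_nonneg fun _ _ => abs_nonneg _) hlast).trans hsub

/-- The nodes below `j` contribute `j!`, the `i` nodes above it `i!`. -/
theorem prod_erase_abs_sub (j i : ℕ) :
    ∏ j' ∈ (Finset.range (j + i + 1)).erase j, |(j : ℝ) - j'|
      = (j.factorial : ℝ) * (i.factorial : ℝ) := by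
  induction i with
  | zero =>
    have h1 : (Finset.range (j + 0 + 1)).erase j = Finset.range j := by
      ext x; simp only [Finset.mem_erase, Finset.mem_range]; omega
    rw [h1]
    cases j with
    | zero => simp
    | succ j =>
      rw [← prod_range_add_one_sub j]
      simp only [Nat.factorial_zero, Nat.cast_one, mul_one]
      refine Finset.prod_congr rfl fun x hx => ?_
      have : (x : ℝ) ≤ j := by exact_mod_cast Nat.lt_succ_iff.1 (Finset.mem_range.1 hx)
      push_cast
      rw [abs_of_nonneg (by linarith)]
  | succ i ih =>
    have h1 : (Finset.range (j + (i + 1) + 1)).erase j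
        = insert (j + i + 1) ((Finset.range (j + i + 1)).erase j) := by
      ext x; simp only [Finset.mem_erase, Finset.mem_range, Finset.mem_insert]; omega
    rw [h1, Finset.prod_insert (by simp), ih, Nat.factorial_succ]
    push_cast
    rw [show (j : ℝ) - (j + i + 1) = -((i : ℝ) + 1) by ring, abs_neg,
      abs_of_nonneg (by positivity)]
    ring

/-- The numerator is at most `r!` and the denominator is `j! (r - j)!`. The binomial form makes the
sum over `j` explicit. -/
theorem abs_natLagrange_le_choose (r j : ℕ) (hj : j ≤ r) (u : ℝ) (h0 : 0 ≤ u) (hr : u ≤ r) :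
    |natLagrange r j u| ≤ (r.choose j : ℝ) := by
  obtain ⟨i, rfl⟩ := Nat.exists_eq_add_of_le hj
  unfold natLagrange
  rw [Finset.abs_prod]
  simp only [abs_div]
  rw [Finset.prod_div_distrib, prod_erase_abs_sub, div_le_iff₀ (by positivity)]
  refine (prod_abs_sub_le_factorial (j + i) j hj u h0 hr).trans (le_of_eq ?_)
  have := Nat.add_choose_mul_factorial_mul_factorial j i
  rw [← this, Nat.choose_symm_add]; push_cast; rw [mul_assoc]

/-- The Lebesgue constant of the nodes `0, …, r` is at most `2 ^ r`. -/
theorem sum_abs_natLagrange_le (r : ℕ) (u : ℝ) (h0 : 0 ≤ u) (hr : u ≤ r) :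
    ∑ j ∈ Finset.range (r + 1), |natLagrange r j u| ≤ 2 ^ r := by
  calc _ ≤ ∑ j ∈ Finset.range (r + 1), (r.choose j : ℝ) :=
        Finset.sum_le_sum fun j hj =>
          abs_natLagrange_le_choose r j (Nat.lt_succ_iff.1 (Finset.mem_range.1 hj)) u h0 hr
    _ = 2 ^ r := by exact_mod_cast Nat.sum_range_choose r

/-! ### The grid -/

theorem one_le_cellNodes (α : ℝ) : 1 ≤ cellNodes α := le_max_left _ _

theorem strictFloor_le_cellNodes (α : ℝ) : strictFloor α ≤ cellNodes α := le_max_right _ _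

theorem gridSize_pos (α : ℝ) (l : ℕ) : 0 < gridSize α l :=
  Nat.mul_pos (one_le_cellNodes α) (by positivity)

theorem gridPoint_mem_baseCube {d : ℕ} (α : ℝ) (l : ℕ) {a : Fin (d - 1) → ℕ}
    (ha : a ∈ lineIndices d α l) : gridPoint α l a ∈ baseCube d := by
  have hM : (0 : ℝ) < gridSize α l := by exact_mod_cast gridSize_pos α l
  rw [lineIndices, Fintype.mem_piFinset] at ha
  refine ⟨fun i => ?_, fun i => ?_⟩
  · simp only [gridPoint, Pi.zero_apply]; positivity
  · simp only [gridPoint, Pi.one_apply]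
    rw [div_le_one hM]
    exact_mod_cast Nat.lt_succ_iff.1 (Finset.mem_range.1 (ha i))

theorem cellIndex_add_one_le {d : ℕ} (l : ℕ) (x : Fin (d - 1) → ℝ) (i : Fin (d - 1)) :
    cellIndex l x i + 1 ≤ 2 ^ l := by
  have : 0 < 2 ^ l := by positivity
  have h : cellIndex l x i ≤ 2 ^ l - 1 := min_le_right _ _
  omega

theorem cellIndex_le {d : ℕ} (l : ℕ) {x : Fin (d - 1) → ℝ} (hx : x ∈ baseCube d)
    (i : Fin (d - 1)) : (cellIndex l x i : ℝ) ≤ x i * 2 ^ l := by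
  have h : cellIndex l x i ≤ ⌊x i * 2 ^ l⌋₊ := min_le_left _ _
  have h0 : 0 ≤ x i := hx.1 i
  exact (Nat.cast_le.2 h).trans (Nat.floor_le (by positivity))

theorem le_cellIndex_add_one {d : ℕ} (l : ℕ) {x : Fin (d - 1) → ℝ} (hx : x ∈ baseCube d)
    (i : Fin (d - 1)) : x i * 2 ^ l ≤ (cellIndex l x i : ℝ) + 1 := by
  have h1 : x i ≤ 1 := hx.2 i
  rcases min_choice ⌊x i * 2 ^ l⌋₊ (2 ^ l - 1) with h | h
  · rw [cellIndex, h]; exact (Nat.lt_floor_add_one _).le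
  · rw [cellIndex, h]
    have : 1 ≤ 2 ^ l := Nat.one_le_two_pow
    push_cast [Nat.cast_sub this]
    nlinarith [pow_pos (two_pos (α := ℝ)) l]

theorem node_mem_lineIndices {d : ℕ} (α : ℝ) (l : ℕ) (x : Fin (d - 1) → ℝ) {j : Fin (d - 1) → ℕ}
    (hj : j ∈ Fintype.piFinset (fun _ : Fin (d - 1) => Finset.range (strictFloor α + 1))) :
    (fun i => cellNodes α * cellIndex l x i + j i) ∈ lineIndices d α l := by
  rw [lineIndices, Fintype.mem_piFinset]
  rw [Fintype.mem_piFinset] at hj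
  intro i
  have h1 := Nat.lt_succ_iff.1 (Finset.mem_range.1 (hj i))
  have h2 := cellIndex_add_one_le l x i
  have h3 := strictFloor_le_cellNodes α
  rw [Finset.mem_range, gridSize, Nat.lt_succ_iff]
  calc cellNodes α * cellIndex l x i + j i ≤ cellNodes α * (cellIndex l x i + 1) := by
        rw [Nat.mul_add, Nat.mul_one]; omega
    _ ≤ _ := Nat.mul_le_mul_left _ h2

/-- Coordinates of `x` relative to the cell `q`, in units of the grid step. -/
noncomputable def cellCoord {d : ℕ} (α : ℝ) (l : ℕ) (q : Fin (d - 1) → ℕ) (x : Fin (d - 1) → ℝ)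
    (i : Fin (d - 1)) : ℝ := x i * gridSize α l - cellNodes α * q i

theorem lagrangeBasis_eq_prod {d : ℕ} (α : ℝ) (l : ℕ) (q j : Fin (d - 1) → ℕ)
    (x : Fin (d - 1) → ℝ) :
    lagrangeBasis α l q j x = ∏ i, natLagrange (strictFloor α) (j i) (cellCoord α l q x i) := by
  have hM : (gridSize α l : ℝ) ≠ 0 := by exact_mod_cast (gridSize_pos α l).ne'
  unfold lagrangeBasis natLagrange cellCoord
  refine Finset.prod_congr rfl fun i _ => Finset.prod_congr rfl fun j' hj' => ?_
  have hne : (j i : ℝ) - j' ≠ 0 := by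
    rw [sub_ne_zero]
    exact_mod_cast (Finset.ne_of_mem_erase hj').symm
  have e1 : x i - ((cellNodes α * q i + j' : ℕ) : ℝ) / gridSize α l
      = (x i * gridSize α l - cellNodes α * q i - j') / gridSize α l := by
    push_cast; field_simp; ring
  have e2 : ((cellNodes α * q i + j i : ℕ) : ℝ) / gridSize α l -
        ((cellNodes α * q i + j' : ℕ) : ℝ) / gridSize α l = ((j i : ℝ) - j') / gridSize α l := by
    push_cast; field_simp; ring
  rw [e1, e2, div_div_div_cancel_right₀ hM]

theorem cellCoord_mem {d : ℕ} (α : ℝ) (l : ℕ) {x : Fin (d - 1) → ℝ} (hx : x ∈ baseCube d)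
    (i : Fin (d - 1)) :
    0 ≤ cellCoord α l (cellIndex l x) x i ∧ cellCoord α l (cellIndex l x) x i ≤ cellNodes α := by
  have h1 := cellIndex_le l hx i
  have h2 := le_cellIndex_add_one l hx i
  have hm : (0 : ℝ) ≤ cellNodes α := Nat.cast_nonneg _
  unfold cellCoord gridSize
  push_cast
  constructor <;> nlinarith

/-- The sum over the tensor grid factors into one-dimensional Lebesgue constants. -/
theorem sum_abs_lagrangeBasis_le {d : ℕ} (α : ℝ) (l : ℕ) {x : Fin (d - 1) → ℝ}
    (hx : x ∈ baseCube d) :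
    ∑ j ∈ Fintype.piFinset (fun _ : Fin (d - 1) => Finset.range (strictFloor α + 1)),
      |lagrangeBasis α l (cellIndex l x) j x| ≤ (2 : ℝ) ^ (strictFloor α * (d - 1)) := by
  simp only [lagrangeBasis_eq_prod, Finset.abs_prod]
  rw [← Finset.prod_univ_sum (fun _ : Fin (d - 1) => Finset.range (strictFloor α + 1))
    (fun i j => |natLagrange (strictFloor α) j (cellCoord α l (cellIndex l x) x i)|)]
  calc _ ≤ ∏ _i : Fin (d - 1), (2 : ℝ) ^ strictFloor α := by
        refine Finset.prod_le_prod (fun _ _ => Finset.sum_nonneg fun _ _ => abs_nonneg _)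
          fun i _ => ?_
        -- For `⌊α⌋ = 0` the cell has width `1` in grid units, beyond the single node `0`, so the
        -- Lebesgue bound on `[0, r]` does not apply; the basis function is the constant `1`.
        rcases Nat.eq_zero_or_pos (strictFloor α) with h0 | hpos
        · simp [h0, natLagrange]
        · obtain ⟨h1, h2⟩ := cellCoord_mem α l hx i
          refine sum_abs_natLagrange_le _ _ h1 (h2.trans (le_of_eq ?_))
          rw [cellNodes, max_eq_right hpos]
    _ = _ := by simp [← pow_mul]

/-- Interpolation of the directional monomials centred at the evaluation point. -/
theorem sum_lagrangeBasis_mul_multilinear {d : ℕ} (α : ℝ) (l k : ℕ) (hk : k ≤ strictFloor α)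
    (x : Fin (d - 1) → ℝ)
    (D : MultilinearMap ℝ (fun _ : Fin k => Fin (d - 1) → ℝ) ℝ) :
    ∑ j ∈ Fintype.piFinset (fun _ : Fin (d - 1) => Finset.range (strictFloor α + 1)),
      lagrangeBasis α l (cellIndex l x) j x *
        D (fun _ => gridPoint α l (fun i => cellNodes α * cellIndex l x i + j i) - x)
      = if k = 0 then D 0 else 0 := by
  classical
  have hM : (gridSize α l : ℝ) ≠ 0 := by exact_mod_cast (gridSize_pos α l).ne'
  set u := cellCoord α l (cellIndex l x) x with hu
  -- Expansion in the standard basis: a choice `f` of basis vectors gives a monomial whose exponent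
  -- in coordinate `i` is the size of the fibre of `f` over `i`. The sum over nodes then factors
  -- over the coordinates, and any positive exponent makes it vanish.
  have hexp : ∀ j : Fin (d - 1) → ℕ,
      D (fun _ => gridPoint α l (fun i => cellNodes α * cellIndex l x i + j i) - x)
      = ∑ f : Fin k → Fin (d - 1), (∏ i, (((j i : ℝ) - u i) / gridSize α l) ^
          (Finset.univ.filter fun s => f s = i).card) * D (fun s => Pi.single (f s) 1) := by
    intro j
    have hv : gridPoint α l (fun i => cellNodes α * cellIndex l x i + j i) - x
        = ∑ i, (((j i : ℝ) - u i) / gridSize α l) • (Pi.single i (1 : ℝ) : Fin (d - 1) → ℝ) := by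
      ext i
      simp only [Pi.sub_apply, gridPoint, Finset.sum_apply, Pi.smul_apply, Pi.single_apply,
        smul_eq_mul, mul_ite, mul_one, mul_zero, Finset.sum_ite_eq, Finset.mem_univ, if_true]
      rw [hu, cellCoord]
      push_cast; field_simp; ring
    rw [hv, MultilinearMap.map_sum]
    refine Finset.sum_congr rfl fun f _ => ?_
    rw [D.map_smul_univ (fun s => ((j (f s) : ℝ) - u (f s)) / gridSize α l)
      (fun s => Pi.single (f s) 1), smul_eq_mul]
    congr 1
    rw [← Finset.prod_fiberwise' Finset.univ f
      (fun i => ((j i : ℝ) - u i) / (gridSize α l : ℝ))]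
    exact Finset.prod_congr rfl fun i _ => by rw [Finset.prod_const]
  simp only [hexp, Finset.mul_sum]
  rw [Finset.sum_comm]
  have hterm : ∀ f : Fin k → Fin (d - 1),
      ∑ j ∈ Fintype.piFinset (fun _ : Fin (d - 1) => Finset.range (strictFloor α + 1)),
        lagrangeBasis α l (cellIndex l x) j x * ((∏ i, (((j i : ℝ) - u i) / gridSize α l) ^
          (Finset.univ.filter fun s => f s = i).card) * D (fun s => Pi.single (f s) 1))
      = (∏ i, (0 : ℝ) ^ (Finset.univ.filter fun s => f s = i).card)
          * D (fun s => Pi.single (f s) 1) := by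
    intro f
    simp only [← mul_assoc]
    rw [← Finset.sum_mul]
    congr 1
    simp only [lagrangeBasis_eq_prod, ← Finset.prod_mul_distrib]
    rw [← Finset.prod_univ_sum (fun _ : Fin (d - 1) => Finset.range (strictFloor α + 1))
      (fun i j => natLagrange (strictFloor α) j (cellCoord α l (cellIndex l x) x i) *
        (((j : ℝ) - u i) / gridSize α l) ^ (Finset.univ.filter fun s => f s = i).card)]
    refine Finset.prod_congr rfl fun i _ => ?_
    have hcard : (Finset.univ.filter fun s => f s = i).card ≤ strictFloor α :=
      ((Finset.card_filter_le _ _).trans (by simp)).trans hk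
    simp only [div_pow, mul_div_assoc']
    rw [← Finset.sum_div, ← hu, sum_natLagrange_mul_pow _ _ hcard]
    rcases Nat.eq_zero_or_pos (Finset.univ.filter fun s => f s = i).card with h | h
    · simp [h]
    · simp [zero_pow h.ne']
  rw [Finset.sum_congr rfl fun f _ => hterm f]
  split_ifs with h0
  · subst h0
    rw [Fintype.sum_unique]
    simp only [Finset.univ_eq_empty, Finset.filter_empty, Finset.card_empty, pow_zero,
      Finset.prod_const_one, one_mul]
    congr 1
    exact Subsingleton.elim _ _
  · refine Finset.sum_eq_zero fun f _ => ?_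
    rw [Finset.prod_eq_zero (Finset.mem_univ (f ⟨0, Nat.pos_of_ne_zero h0⟩)), zero_mul]
    refine zero_pow (Finset.card_pos.2 ⟨⟨0, Nat.pos_of_ne_zero h0⟩, by simp⟩).ne'

/-- The Taylor polynomial is centred at the evaluation point, so only its term of order zero
survives. -/
theorem sum_lagrangeBasis_mul_taylorPoly {d : ℕ} (α : ℝ) (l : ℕ) (g : (Fin (d - 1) → ℝ) → ℝ)
    (x : Fin (d - 1) → ℝ) :
    ∑ j ∈ Fintype.piFinset (fun _ : Fin (d - 1) => Finset.range (strictFloor α + 1)),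
      taylorPoly g (strictFloor α) x
          (gridPoint α l (fun i => cellNodes α * cellIndex l x i + j i)) *
        lagrangeBasis α l (cellIndex l x) j x = g x := by
  simp only [taylorPoly, Finset.sum_mul]
  rw [Finset.sum_comm]
  have hterm : ∀ k ∈ Finset.range (strictFloor α + 1),
      ∑ j ∈ Fintype.piFinset (fun _ : Fin (d - 1) => Finset.range (strictFloor α + 1)),
        1 / (k.factorial : ℝ) * iteratedFDerivWithin ℝ k g (baseCube d) x
            (fun _ => gridPoint α l (fun i => cellNodes α * cellIndex l x i + j i) - x) *
          lagrangeBasis α l (cellIndex l x) j x = if k = 0 then g x else 0 := by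
    intro k hk
    have h := sum_lagrangeBasis_mul_multilinear α l k
      (Nat.lt_succ_iff.1 (Finset.mem_range.1 hk)) x
      (iteratedFDerivWithin ℝ k g (baseCube d) x).toMultilinearMap
    have h2 : ∀ j : Fin (d - 1) → ℕ, 1 / (k.factorial : ℝ) *
        iteratedFDerivWithin ℝ k g (baseCube d) x
            (fun _ => gridPoint α l (fun i => cellNodes α * cellIndex l x i + j i) - x) *
          lagrangeBasis α l (cellIndex l x) j x
        = 1 / (k.factorial : ℝ) * (lagrangeBasis α l (cellIndex l x) j x *
          (iteratedFDerivWithin ℝ k g (baseCube d) x).toMultilinearMap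
            (fun _ => gridPoint α l (fun i => cellNodes α * cellIndex l x i + j i) - x)) := by
      intro j
      simp only [ContinuousMultilinearMap.coe_coe]
      ring
    simp only [h2]
    rw [← Finset.mul_sum, h]
    split_ifs with h0
    · subst h0
      simp [iteratedFDerivWithin_zero_apply]
    · simp
  rw [Finset.sum_congr rfl hterm]
  simp

/-- No accuracy of the thresholds is assumed; this serves the shallow depths where accuracy is not
controlled. -/
theorem abs_interpolant_le {d : ℕ} (α : ℝ) (l : ℕ) {T : (Fin (d - 1) → ℕ) → ℝ}
    (hT : ∀ a ∈ lineIndices d α l, |T a| ≤ 1) {x : Fin (d - 1) → ℝ} (hx : x ∈ baseCube d) :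
    |interpolant α l T x| ≤ (2 : ℝ) ^ (strictFloor α * (d - 1)) := by
  refine le_trans ?_ (sum_abs_lagrangeBasis_le α l hx)
  refine (Finset.abs_sum_le_sum_abs _ _).trans (Finset.sum_le_sum fun j hj => ?_)
  rw [abs_mul]
  exact mul_le_of_le_one_left (abs_nonneg _) (hT _ (node_mem_lineIndices α l x hj))

theorem norm_node_sub_le {d : ℕ} (α : ℝ) (l : ℕ) {x : Fin (d - 1) → ℝ} (hx : x ∈ baseCube d)
    {j : Fin (d - 1) → ℕ}
    (hj : j ∈ Fintype.piFinset (fun _ : Fin (d - 1) => Finset.range (strictFloor α + 1))) :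
    ‖gridPoint α l (fun i => cellNodes α * cellIndex l x i + j i) - x‖ ≤ ((2 : ℝ) ^ l)⁻¹ := by
  rw [pi_norm_le_iff_of_nonneg (by positivity)]
  intro i
  rw [Fintype.mem_piFinset] at hj
  have h1 : (j i : ℝ) ≤ cellNodes α := by
    exact_mod_cast (Nat.lt_succ_iff.1 (Finset.mem_range.1 (hj i))).trans
      (strictFloor_le_cellNodes α)
  have hm : (1 : ℝ) ≤ cellNodes α := by exact_mod_cast one_le_cellNodes α
  have h2 := cellIndex_le l hx i
  have h3 := le_cellIndex_add_one l hx i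
  have hpow : (0 : ℝ) < 2 ^ l := by positivity
  have e : (gridPoint α l (fun i => cellNodes α * cellIndex l x i + j i) - x) i
      = ((cellIndex l x i : ℝ) + j i / cellNodes α - x i * 2 ^ l) * ((2 : ℝ) ^ l)⁻¹ := by
    simp only [Pi.sub_apply, gridPoint, gridSize]
    push_cast
    field_simp
  rw [e, Real.norm_eq_abs, abs_mul, abs_of_pos (inv_pos.2 hpow)]
  refine mul_le_of_le_one_left (inv_pos.2 hpow).le ?_
  have h4 : (j i : ℝ) / cellNodes α ≤ 1 := (div_le_one (by linarith)).2 h1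
  have h5 : 0 ≤ (j i : ℝ) / cellNodes α := by positivity
  rw [abs_le]; constructor <;> linarith

/-- By reproduction, the error is the interpolant of the differences between `T` and the Taylor
polynomial at the nodes. Each is at most a search error plus a Taylor remainder, and all nodes lie
within `2 ^ (-l)` of `x`. -/
theorem abs_interpolant_sub_le {d : ℕ} {lam α ε : ℝ} (hlam : 0 ≤ lam) (hα : 0 < α) (l : ℕ)
    {g : (Fin (d - 1) → ℝ) → ℝ} (hg : HolderClass d lam α g) {T : (Fin (d - 1) → ℕ) → ℝ}
    (hT : ∀ a ∈ lineIndices d α l, |T a - g (gridPoint α l a)| ≤ ε)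
    {x : Fin (d - 1) → ℝ} (hx : x ∈ baseCube d) :
    |interpolant α l T x - g x|
      ≤ (2 : ℝ) ^ (strictFloor α * (d - 1)) * (ε + lam * (((2 : ℝ) ^ l)⁻¹) ^ α) := by
  have h0 : 0 ≤ ε + lam * (((2 : ℝ) ^ l)⁻¹) ^ α := by
    have hz : (0 : Fin (d - 1) → ℕ) ∈ lineIndices d α l := by
      simp [lineIndices, Fintype.mem_piFinset]
    have := (abs_nonneg _).trans (hT _ hz)
    positivity
  rw [← sum_lagrangeBasis_mul_taylorPoly α l g x, interpolant, ← Finset.sum_sub_distrib]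
  refine (Finset.abs_sum_le_sum_abs _ _).trans ?_
  refine le_trans (Finset.sum_le_sum (g := fun j => |lagrangeBasis α l (cellIndex l x) j x| *
    (ε + lam * (((2 : ℝ) ^ l)⁻¹) ^ α)) fun j hj => ?_) ?_
  · have hn := node_mem_lineIndices α l x hj
    rw [← sub_mul, abs_mul, mul_comm]
    refine mul_le_mul_of_nonneg_left ?_ (abs_nonneg _)
    refine (abs_sub_le _ (g (gridPoint α l (fun i => cellNodes α * cellIndex l x i + j i)))
      _).trans (add_le_add (hT _ hn) ?_)
    refine (hg.taylor α hα le_rfl _ (gridPoint_mem_baseCube α l hn) x hx).trans ?_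
    exact mul_le_mul_of_nonneg_left
      (Real.rpow_le_rpow (norm_nonneg _) (norm_node_sub_le α l hx hj) hα.le) hlam
  · rw [← Finset.sum_mul]
    exact mul_le_mul_of_nonneg_right (sum_abs_lagrangeBasis_le α l hx) h0

theorem measurable_interpolant {d : ℕ} (α : ℝ) (l : ℕ) (T : (Fin (d - 1) → ℕ) → ℝ) :
    Measurable (interpolant α l T : (Fin (d - 1) → ℝ) → ℝ) := by
  have hq : Measurable (cellIndex l : (Fin (d - 1) → ℝ) → (Fin (d - 1) → ℕ)) := by
    refine measurable_pi_lambda _ fun i => ?_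
    unfold cellIndex
    exact (Nat.measurable_floor.comp ((measurable_pi_apply i).mul_const _)).min measurable_const
  unfold interpolant
  refine Finset.measurable_sum _ fun j _ => ?_
  have h : ∀ f : (Fin (d - 1) → ℕ) → ℝ, Measurable fun x : Fin (d - 1) → ℝ => f (cellIndex l x) :=
    fun f => (measurable_of_countable f).comp hq
  refine (h fun q => T fun i => cellNodes α * q i + j i).mul ?_
  unfold lagrangeBasis
  refine Finset.measurable_prod _ fun i _ => Finset.measurable_prod _ fun j' _ => ?_
  refine Measurable.div ((measurable_pi_apply i).sub ?_) ?_
  · exact h fun q => ((cellNodes α * q i + j' : ℕ) : ℝ) / gridSize α l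
  · exact h fun q => ((cellNodes α * q i + j i : ℕ) : ℝ) / gridSize α l -
        ((cellNodes α * q i + j' : ℕ) : ℝ) / gridSize α l

/-! ### Epochs of the line search -/

/-- The quartiles of the interval `[I.1, I.2]`. -/
noncomputable def quartile (j : Fin 3) (I : ℝ × ℝ) : ℝ :=
  ![(I.2 - I.1) / 4 + I.1, (I.1 + I.2) / 2, (I.2 - I.1) / 4 + (I.1 + I.2) / 2] j

open Classical in
/-- The intervals that can occur after `k` epochs. -/
noncomputable def reachable : ℕ → Finset (ℝ × ℝ)
  | 0 => {(0, 1)}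
  | k + 1 => (reachable k).biUnion fun I =>
      {(I.1, quartile 1 I), (quartile 1 I, I.2), (quartile 0 I, quartile 2 I)}

theorem card_reachable_le (k : ℕ) : (reachable k).card ≤ 3 ^ k := by
  classical
  induction k with
  | zero => simp [reachable]
  | succ k ih =>
    rw [reachable, pow_succ]
    exact (Finset.card_biUnion_le_card_mul _ _ 3 fun _ _ => Finset.card_le_three).trans
      (Nat.mul_le_mul_right _ ih)

theorem mem_reachable {k : ℕ} {I : ℝ × ℝ} (hI : I ∈ reachable k) :
    0 ≤ I.1 ∧ I.2 ≤ 1 ∧ I.2 - I.1 = ((2 : ℝ) ^ k)⁻¹ := by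
  classical
  induction k generalizing I with
  | zero =>
    rw [reachable, Finset.mem_singleton] at hI
    subst hI; norm_num
  | succ k ih =>
    rw [reachable, Finset.mem_biUnion] at hI
    obtain ⟨J, hJ, hI⟩ := hI
    obtain ⟨h1, h2, h3⟩ := ih hJ
    have hp : (0 : ℝ) < ((2 : ℝ) ^ k)⁻¹ := by positivity
    have e : ((2 : ℝ) ^ (k + 1))⁻¹ = ((2 : ℝ) ^ k)⁻¹ / 2 := by
      rw [pow_succ, mul_inv]; ring
    simp only [Finset.mem_insert, Finset.mem_singleton] at hI
    rw [e]
    rcases hI with rfl | rfl | rfl <;> simp [quartile] <;> refine ⟨?_, ?_, ?_⟩ <;> linarith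

theorem quartile_mem {k : ℕ} {I : ℝ × ℝ} (hI : I ∈ reachable k) (j : Fin 3) :
    quartile j I ∈ Set.Icc (0 : ℝ) 1 := by
  obtain ⟨h1, h2, h3⟩ := mem_reachable hI
  have hp : (0 : ℝ) < ((2 : ℝ) ^ k)⁻¹ := by positivity
  fin_cases j <;> simp [quartile] <;> constructor <;> linarith

theorem conf_le_conf {δ δ' : ℝ} (h' : 0 < δ') (h : δ' ≤ δ) (t : ℕ) (ht : 1 ≤ t) :
    conf δ t ≤ conf δ' t := by
  have ht' : (0 : ℝ) < t := by exact_mod_cast ht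
  unfold conf
  have : 0 < δ := h'.trans_le h
  gcongr

theorem epochRun_fst_le (y : Fin 3 → ℕ → ℝ → Bool) (δ : ℝ) (I : ℝ × ℝ) (B : ℕ) :
    (epochRun y δ I B).1 ≤ B := by
  classical
  unfold epochRun
  dsimp only
  split_ifs with h <;> first | exact (Nat.find_spec h).2.1 | exact Nat.mul_div_le B 3

theorem epochRun_eq_some {y : Fin 3 → ℕ → ℝ → Bool} {δ : ℝ} {I J : ℝ × ℝ} {B : ℕ}
    (h : (epochRun y δ I B).2 = some J) :
    ∃ t, 1 ≤ t ∧ (epochRun y δ I B).1 = 3 * t ∧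
      ((conf δ t ≤ |empMean (fun i => y 1 i (quartile 1 I)) t - 1 / 2| ∧
          ((1 / 2 < empMean (fun i => y 1 i (quartile 1 I)) t ∧ J = (I.1, quartile 1 I)) ∨
            (empMean (fun i => y 1 i (quartile 1 I)) t ≤ 1 / 2 ∧ J = (quartile 1 I, I.2)))) ∨
        (conf δ t ≤ empMean (fun i => y 2 i (quartile 2 I)) t - 1 / 2 ∧
          conf δ t ≤ 1 / 2 - empMean (fun i => y 0 i (quartile 0 I)) t ∧
          J = (quartile 0 I, quartile 2 I))) := by
  classical
  unfold epochRun at h ⊢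
  dsimp only at h ⊢
  by_cases hex : ∃ t, 1 ≤ t ∧ 3 * t ≤ B ∧ (MidDecided (fun i => y 1 i ((I.1 + I.2) / 2)) δ t ∨
      OuterDecided (fun i => y 0 i ((I.2 - I.1) / 4 + I.1))
        (fun i => y 2 i ((I.2 - I.1) / 4 + (I.1 + I.2) / 2)) δ t)
  · rw [dif_pos hex] at h ⊢
    refine ⟨Nat.find hex, (Nat.find_spec hex).1, rfl, ?_⟩
    have hs := (Nat.find_spec hex).2.2
    rw [Option.some.injEq] at h
    split_ifs at h with hmid hhalf
    · exact Or.inl ⟨hmid, Or.inl ⟨hhalf, h.symm⟩⟩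
    · exact Or.inl ⟨hmid, Or.inr ⟨not_lt.1 hhalf, h.symm⟩⟩
    · obtain ⟨h1, h2⟩ := hs.resolve_left hmid
      exact Or.inr ⟨h1, h2, h.symm⟩
  · rw [dif_neg hex] at h
    exact absurd h (by simp)

theorem epochRun_mem_reachable {y : Fin 3 → ℕ → ℝ → Bool} {δ : ℝ} {I J : ℝ × ℝ} {B k : ℕ}
    (hI : I ∈ reachable k) (h : (epochRun y δ I B).2 = some J) : J ∈ reachable (k + 1) := by
  classical
  rw [reachable, Finset.mem_biUnion]
  refine ⟨I, hI, ?_⟩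
  simp only [Finset.mem_insert, Finset.mem_singleton]
  obtain ⟨t, -, -, ⟨-, ⟨-, h⟩ | ⟨-, h⟩⟩ | ⟨-, -, h⟩⟩ := epochRun_eq_some h
  · exact Or.inl h
  · exact Or.inr (Or.inl h)
  · exact Or.inr (Or.inr h)

/-- If all empirical means are within the confidence term, then an epoch keeps the threshold in
the current interval. -/
theorem mem_of_epochRun_eq_some {y : Fin 3 → ℕ → ℝ → Bool} {δ θ : ℝ} {η : ℝ → ℝ}
    {I J : ℝ × ℝ} {B k : ℕ} (hI : I ∈ reachable k)
    (hη : ∀ z ∈ Set.Icc (0 : ℝ) 1, (1 / 2 ≤ η z ↔ θ ≤ z))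
    (hdev : ∀ j t, 1 ≤ t →
      |empMean (fun i => y j i (quartile j I)) t - η (quartile j I)| < conf δ t)
    (hθ : θ ∈ Set.Icc I.1 I.2) (h : (epochRun y δ I B).2 = some J) : θ ∈ Set.Icc J.1 J.2 := by
  have above : ∀ j t, 1 ≤ t → conf δ t ≤ empMean (fun i => y j i (quartile j I)) t - 1 / 2 →
      θ ≤ quartile j I := by
    intro j t ht hc
    rw [← hη _ (quartile_mem hI j)]
    have := (abs_lt.1 (hdev j t ht)).2
    linarith
  have below : ∀ j t, 1 ≤ t → conf δ t ≤ 1 / 2 - empMean (fun i => y j i (quartile j I)) t →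
      quartile j I ≤ θ := by
    intro j t ht hc
    by_contra hcon
    have h1 := (hη _ (quartile_mem hI j)).2 (not_le.1 hcon).le
    have := (abs_lt.1 (hdev j t ht)).1
    linarith
  obtain ⟨t, ht, -, ⟨hc, ⟨hm, rfl⟩ | ⟨hm, rfl⟩⟩ | ⟨h1, h2, rfl⟩⟩ := epochRun_eq_some h
  · rw [abs_of_pos (by linarith)] at hc
    exact ⟨hθ.1, above 1 t ht hc⟩
  · rw [abs_of_nonpos (by linarith)] at hc
    exact ⟨below 1 t ht (by linarith), hθ.2⟩
  · exact ⟨below 0 t ht h2, above 2 t ht h1⟩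

/-- An epoch ends by round `τ` if the confidence term at `τ` is less than half the noise margin.
The threshold may lie outside of the current interval. -/
theorem epochRun_terminates {y : Fin 3 → ℕ → ℝ → Bool} {δ θ w gap : ℝ} {η : ℝ → ℝ}
    {I : ℝ × ℝ} {B k τ : ℕ} (hI : I ∈ reachable k)
    (hη : ∀ z ∈ Set.Icc (0 : ℝ) 1, (1 / 2 ≤ η z ↔ θ ≤ z))
    (hgap : ∀ z ∈ Set.Icc (0 : ℝ) 1, ((2 : ℝ) ^ k)⁻¹ / 8 ≤ |z - θ| → gap ≤ |η z - 1 / 2|)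
    (hτ : 1 ≤ τ) (hB : 3 * τ ≤ B) (hw : conf δ τ ≤ w) (hwgap : 2 * w ≤ gap)
    (hdev : ∀ j, |empMean (fun i => y j i (quartile j I)) τ - η (quartile j I)| < w) :
    ∃ J, (epochRun y δ I B).2 = some J ∧ (epochRun y δ I B).1 ≤ 3 * τ := by
  obtain ⟨h0, h1, h2⟩ := mem_reachable hI
  have hp : (0 : ℝ) < ((2 : ℝ) ^ k)⁻¹ := by positivity
  have hdec : conf δ τ ≤ |empMean (fun i => y 1 i (quartile 1 I)) τ - 1 / 2| ∨
      (conf δ τ ≤ empMean (fun i => y 2 i (quartile 2 I)) τ - 1 / 2 ∧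
          conf δ τ ≤ 1 / 2 - empMean (fun i => y 0 i (quartile 0 I)) τ) := by
    -- If the middle point is closer than `2 ^ (-k) / 8` to `θ`, the outer points, at distance `2 ^
    -- (-k) / 4` from it, lie on opposite sides of `θ` and at least `2 ^ (-k) / 8` away.
    by_cases hmid : ((2 : ℝ) ^ k)⁻¹ / 8 ≤ |quartile 1 I - θ|
    · left
      have hg := hgap _ (quartile_mem hI 1) hmid
      have hd := hdev 1
      have := abs_sub_abs_le_abs_sub (η (quartile 1 I) - 1 / 2)
        (empMean (fun i => y 1 i (quartile 1 I)) τ - 1 / 2)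
      rw [sub_sub_sub_cancel_right, abs_sub_comm (η (quartile 1 I)) (empMean _ _)] at this
      linarith
    · right
      push Not at hmid
      rw [abs_lt] at hmid
      have e0 : quartile 0 I = quartile 1 I - (I.2 - I.1) / 4 := by simp [quartile]; ring
      have e2 : quartile 2 I = quartile 1 I + (I.2 - I.1) / 4 := by simp [quartile]; ring
      constructor
      · have hle : θ ≤ quartile 2 I := by rw [e2, h2]; linarith
        have hg := hgap _ (quartile_mem hI 2) (by
          rw [abs_of_nonneg (by linarith), e2, h2]; linarith)
        rw [abs_of_nonneg (by linarith [(hη _ (quartile_mem hI 2)).2 hle])] at hg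
        linarith [(abs_lt.1 (hdev 2)).1]
      · have hlt : quartile 0 I < θ := by rw [e0, h2]; linarith
        have hneg : η (quartile 0 I) < 1 / 2 := by
          by_contra hcon
          exact absurd ((hη _ (quartile_mem hI 0)).1 (not_lt.1 hcon)) (not_le.2 hlt)
        have hg := hgap _ (quartile_mem hI 0) (by
          rw [abs_of_neg (by linarith), e0, h2]; linarith)
        rw [abs_of_neg (by linarith)] at hg
        linarith [(abs_lt.1 (hdev 0)).2]
  classical
  unfold epochRun
  dsimp only
  have hex : ∃ t, 1 ≤ t ∧ 3 * t ≤ B ∧ (MidDecided (fun i => y 1 i ((I.1 + I.2) / 2)) δ t ∨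
      OuterDecided (fun i => y 0 i ((I.2 - I.1) / 4 + I.1))
        (fun i => y 2 i ((I.2 - I.1) / 4 + (I.1 + I.2) / 2)) δ t) := ⟨τ, hτ, hB, hdec⟩
  rw [dif_pos hex]
  exact ⟨_, rfl, Nat.mul_le_mul_left 3 (Nat.find_min' hex ⟨hτ, hB, hdec⟩)⟩

theorem epochs_succ_of_some {y : ℕ → Fin 3 → ℕ → ℝ → Bool} {δ : ℝ} {K B k : ℕ} {I : ℝ × ℝ}
    (h : (epochs y δ K B k).2 = some I) :
    epochs y δ K B (k + 1) =
      ((epochs y δ K B k).1 +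
        (epochRun (y (k + 1)) (δ / (K * 2 ^ (k + 1))) I (B - (epochs y δ K B k).1)).1,
        (epochRun (y (k + 1)) (δ / (K * 2 ^ (k + 1))) I (B - (epochs y δ K B k).1)).2) := by
  rw [epochs]
  rcases hE : epochs y δ K B k with ⟨N, _ | J⟩
  · rw [hE] at h; exact absurd h (by simp)
  · rw [hE] at h
    obtain rfl : J = I := Option.some.inj h
    rfl

theorem epochs_succ_of_none {y : ℕ → Fin 3 → ℕ → ℝ → Bool} {δ : ℝ} {K B k : ℕ}
    (h : (epochs y δ K B k).2 = none) : epochs y δ K B (k + 1) = epochs y δ K B k := by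
  rw [epochs]
  rcases hE : epochs y δ K B k with ⟨N, _ | J⟩
  · rfl
  · rw [hE] at h; exact absurd h (by simp)

theorem epochs_succ_eq_some {y : ℕ → Fin 3 → ℕ → ℝ → Bool} {δ : ℝ} {K B k : ℕ} {J : ℝ × ℝ}
    (h : (epochs y δ K B (k + 1)).2 = some J) : ∃ I, (epochs y δ K B k).2 = some I ∧
      (epochRun (y (k + 1)) (δ / (K * 2 ^ (k + 1))) I (B - (epochs y δ K B k).1)).2 = some J := by
  rcases hE : (epochs y δ K B k).2 with _ | I
  · rw [epochs_succ_of_none hE, hE] at h; exact absurd h (by simp)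
  · rw [epochs_succ_of_some hE] at h
    exact ⟨I, rfl, h⟩

theorem epochs_fst_le (y : ℕ → Fin 3 → ℕ → ℝ → Bool) (δ : ℝ) (K B k : ℕ) :
    (epochs y δ K B k).1 ≤ B := by
  induction k with
  | zero => simp [epochs]
  | succ k ih =>
    rcases hE : (epochs y δ K B k).2 with _ | I
    · rwa [epochs_succ_of_none hE]
    · rw [epochs_succ_of_some hE]
      have := epochRun_fst_le (y (k + 1)) (δ / (K * 2 ^ (k + 1))) I (B - (epochs y δ K B k).1)
      dsimp only
      omega

theorem epochs_mem_reachable {y : ℕ → Fin 3 → ℕ → ℝ → Bool} {δ : ℝ} {K B k : ℕ} {I : ℝ × ℝ}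
    (h : (epochs y δ K B k).2 = some I) : I ∈ reachable k := by
  induction k generalizing I with
  | zero =>
    obtain rfl : (0, 1) = I := Option.some.inj h
    simp [reachable]
  | succ k ih =>
    obtain ⟨J, hJ, hI⟩ := epochs_succ_eq_some h
    exact epochRun_mem_reachable (ih hJ) hI

theorem epochs_pos {y : ℕ → Fin 3 → ℕ → ℝ → Bool} {δ : ℝ} {K B k : ℕ} {J : ℝ × ℝ}
    (h : (epochs y δ K B (k + 1)).2 = some J) : 1 ≤ (epochs y δ K B (k + 1)).1 := by
  obtain ⟨I, hI, hJ⟩ := epochs_succ_eq_some h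
  obtain ⟨t, ht, he, -⟩ := epochRun_eq_some hJ
  rw [epochs_succ_of_some hI]
  dsimp only
  omega

/-- All empirical means along a line, at the points that the search may visit, are within the
confidence term. -/
def LineDeviation (y : ℕ → Fin 3 → ℕ → ℝ → Bool) (η : ℝ → ℝ) (δ : ℝ) (K : ℕ) : Prop :=
  ∀ k < K, ∀ I ∈ reachable k, ∀ j t, 1 ≤ t →
    |empMean (fun i => y (k + 1) j i (quartile j I)) t - η (quartile j I)|
      < conf (δ / (K * 2 ^ (k + 1))) t

theorem mem_of_epochs_eq_some {y : ℕ → Fin 3 → ℕ → ℝ → Bool} {δ θ : ℝ} {η : ℝ → ℝ}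
    {K B k : ℕ} {I : ℝ × ℝ} (hη : ∀ z ∈ Set.Icc (0 : ℝ) 1, (1 / 2 ≤ η z ↔ θ ≤ z))
    (hdev : LineDeviation y η δ K) (hθ : θ ∈ Set.Icc (0 : ℝ) 1) (hk : k ≤ K)
    (h : (epochs y δ K B k).2 = some I) : θ ∈ Set.Icc I.1 I.2 := by
  induction k generalizing I with
  | zero =>
    obtain rfl : (0, 1) = I := Option.some.inj h
    exact hθ
  | succ k ih =>
    obtain ⟨J, hJ, hI⟩ := epochs_succ_eq_some h
    have hr := epochs_mem_reachable hJ
    exact mem_of_epochRun_eq_some hr hη (fun j t ht => hdev k hk J hr j t ht)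
      (ih (Nat.le_of_succ_le hk) hJ) hI

/-- The search runs with `δ`, while deviations are controlled only at a smaller `δ'`, that is, by
larger confidence terms. This suffices for termination, where the position of `θ` relative to the
current interval is irrelevant. -/
theorem epochs_terminates {y : ℕ → Fin 3 → ℕ → ℝ → Bool} {δ δ' θ : ℝ} {η : ℝ → ℝ}
    {K B : ℕ} {gap : ℕ → ℝ} {τ : ℕ → ℕ} (hδ' : 0 < δ') (hle : δ' ≤ δ)
    (hη : ∀ z ∈ Set.Icc (0 : ℝ) 1, (1 / 2 ≤ η z ↔ θ ≤ z))
    (hgap : ∀ k < K, ∀ z ∈ Set.Icc (0 : ℝ) 1,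
      ((2 : ℝ) ^ k)⁻¹ / 8 ≤ |z - θ| → gap k ≤ |η z - 1 / 2|)
    (hτ : ∀ k < K, 1 ≤ τ k) (hB : ∑ k ∈ Finset.range K, 3 * τ k ≤ B)
    (hconf : ∀ k < K, 2 * conf (δ' / (K * 2 ^ (k + 1))) (τ k) ≤ gap k)
    (hdev : LineDeviation y η δ' K) {k : ℕ} (hk : k ≤ K) :
    ∃ I, (epochs y δ K B k).2 = some I ∧
      (epochs y δ K B k).1 ≤ ∑ i ∈ Finset.range k, 3 * τ i := by
  induction k with
  | zero => exact ⟨(0, 1), rfl, by simp [epochs]⟩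
  | succ k ih =>
    obtain ⟨I, hI, hc⟩ := ih (Nat.le_of_succ_le hk)
    have hr := epochs_mem_reachable hI
    have hsum : ∑ i ∈ Finset.range (k + 1), 3 * τ i ≤ B :=
      (Finset.sum_le_sum_of_subset (Finset.range_mono hk)).trans hB
    rw [Finset.sum_range_succ] at hsum ⊢
    rw [epochs_succ_of_some hI]
    dsimp only
    have hKpos : 0 < K := lt_of_lt_of_le (Nat.succ_pos k) hk
    have hKr : (0 : ℝ) < K := by exact_mod_cast hKpos
    have h1 := hτ k hk
    obtain ⟨J, hJ, hcost⟩ := epochRun_terminates (y := y (k + 1))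
      (δ := δ / (K * 2 ^ (k + 1))) (B := B - (epochs y δ K B k).1) (τ := τ k) hr hη
      (hgap k hk) h1 (by omega)
      (conf_le_conf (δ' := δ' / (K * 2 ^ (k + 1))) (by positivity) (by gcongr) _ h1)
      (hconf k hk) (fun j => hdev k hk I hr j (τ k) h1)
    exact ⟨J, hJ, by omega⟩

/-! ### The line search -/

theorem inv_two_pow_numEpochs_le {ε : ℝ} (hε : 0 < ε) :
    ((2 : ℝ) ^ numEpochs ε)⁻¹ / 2 ≤ ε := by
  have h : Real.logb 2 (1 / (2 * ε)) ≤ numEpochs ε := Nat.le_ceil _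
  rw [Real.logb_le_iff_le_rpow (by norm_num) (by positivity), Real.rpow_natCast] at h
  have hp : (0 : ℝ) < 2 ^ numEpochs ε := by positivity
  rw [div_le_iff₀ (by positivity)] at h
  rw [div_le_iff₀ (by norm_num), inv_le_iff_one_le_mul₀ hp]
  linarith

theorem lineSearch_fst_le (y : ℕ → Fin 3 → ℕ → ℝ → Bool) (ε δ : ℝ) (B : ℕ) :
    (lineSearch y ε δ B).1 ≤ B := epochs_fst_le _ _ _ _ _

theorem lineSearch_eq_some {y : ℕ → Fin 3 → ℕ → ℝ → Bool} {ε δ T : ℝ} {B : ℕ}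
    (h : (lineSearch y ε δ B).2 = some T) :
    ∃ I, (epochs y δ (numEpochs ε) B (numEpochs ε)).2 = some I ∧ (I.1 + I.2) / 2 = T := by
  unfold lineSearch at h
  simpa [Option.map_eq_some_iff] using h

theorem lineSearch_mem {y : ℕ → Fin 3 → ℕ → ℝ → Bool} {ε δ T : ℝ} {B : ℕ}
    (h : (lineSearch y ε δ B).2 = some T) : T ∈ Set.Icc (0 : ℝ) 1 := by
  obtain ⟨I, hI, rfl⟩ := lineSearch_eq_some h
  simpa [quartile] using quartile_mem (epochs_mem_reachable hI) 1

theorem lineSearch_pos {y : ℕ → Fin 3 → ℕ → ℝ → Bool} {ε δ T : ℝ} {B : ℕ}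
    (hε : 0 < numEpochs ε) (h : (lineSearch y ε δ B).2 = some T) :
    1 ≤ (lineSearch y ε δ B).1 := by
  obtain ⟨I, hI, rfl⟩ := lineSearch_eq_some h
  obtain ⟨k, hk⟩ := Nat.exists_eq_succ_of_ne_zero hε.ne'
  unfold lineSearch
  dsimp only
  generalize numEpochs ε = K at *
  subst hk
  exact epochs_pos hI

theorem abs_lineSearch_sub_le {y : ℕ → Fin 3 → ℕ → ℝ → Bool} {ε δ θ T : ℝ} {η : ℝ → ℝ}
    {B : ℕ} (hε : 0 < ε) (hη : ∀ z ∈ Set.Icc (0 : ℝ) 1, (1 / 2 ≤ η z ↔ θ ≤ z))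
    (hdev : LineDeviation y η δ (numEpochs ε)) (hθ : θ ∈ Set.Icc (0 : ℝ) 1)
    (h : (lineSearch y ε δ B).2 = some T) : |T - θ| ≤ ε := by
  obtain ⟨I, hI, rfl⟩ := lineSearch_eq_some h
  obtain ⟨h1, h2⟩ := mem_of_epochs_eq_some hη hdev hθ le_rfl hI
  obtain ⟨-, -, h3⟩ := mem_reachable (epochs_mem_reachable hI)
  have h4 := inv_two_pow_numEpochs_le hε
  rw [← h3] at h4
  rw [abs_le]; constructor <;> linarith

theorem lineSearch_terminates {y : ℕ → Fin 3 → ℕ → ℝ → Bool} {ε δ δ' θ : ℝ} {η : ℝ → ℝ}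
    {B : ℕ} {gap : ℕ → ℝ} {τ : ℕ → ℕ} (hδ' : 0 < δ') (hle : δ' ≤ δ)
    (hη : ∀ z ∈ Set.Icc (0 : ℝ) 1, (1 / 2 ≤ η z ↔ θ ≤ z))
    (hgap : ∀ k < numEpochs ε, ∀ z ∈ Set.Icc (0 : ℝ) 1,
      ((2 : ℝ) ^ k)⁻¹ / 8 ≤ |z - θ| → gap k ≤ |η z - 1 / 2|)
    (hτ : ∀ k < numEpochs ε, 1 ≤ τ k)
    (hB : ∑ k ∈ Finset.range (numEpochs ε), 3 * τ k ≤ B)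
    (hconf : ∀ k < numEpochs ε, 2 * conf (δ' / (numEpochs ε * 2 ^ (k + 1))) (τ k) ≤ gap k)
    (hdev : LineDeviation y η δ' (numEpochs ε)) :
    ∃ T, (lineSearch y ε δ B).2 = some T ∧
      (lineSearch y ε δ B).1 ≤ ∑ k ∈ Finset.range (numEpochs ε), 3 * τ k := by
  obtain ⟨I, hI, hc⟩ := epochs_terminates hδ' hle hη hgap hτ hB hconf hdev le_rfl
  exact ⟨(I.1 + I.2) / 2, by simp [lineSearch, hI], hc⟩

/-! ### The main loop -/

section MainLoop

variable {d : ℕ} (y : Request d → Point d → Bool) (n : ℕ) (δ lam α : ℝ)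

theorem searchLines_cons_of_some {l B : ℕ} {a : Fin (d - 1) → ℕ} {as : List (Fin (d - 1) → ℕ)}
    {T : (Fin (d - 1) → ℕ) → ℝ} (h : (searchLines y δ lam α l B as).2 = some T) :
    searchLines y δ lam α l B (a :: as) =
      ((searchLines y δ lam α l B as).1 +
        (searchLine y δ lam α l a (B - (searchLines y δ lam α l B as).1)).1,
        (searchLine y δ lam α l a (B - (searchLines y δ lam α l B as).1)).2.map
          fun τ => Function.update T a τ) := by
  rw [searchLines]
  rcases hE : searchLines y δ lam α l B as with ⟨N, _ | J⟩
  · rw [hE] at h; exact absurd h (by simp)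
  · rw [hE] at h
    obtain rfl : J = T := Option.some.inj h
    rfl

theorem searchLines_cons_of_none {l B : ℕ} {a : Fin (d - 1) → ℕ} {as : List (Fin (d - 1) → ℕ)}
    (h : (searchLines y δ lam α l B as).2 = none) :
    searchLines y δ lam α l B (a :: as) = searchLines y δ lam α l B as := by
  rw [searchLines]
  rcases hE : searchLines y δ lam α l B as with ⟨N, _ | J⟩
  · rfl
  · rw [hE] at h; exact absurd h (by simp)

theorem searchLines_cons_eq_some {l B : ℕ} {a : Fin (d - 1) → ℕ} {as : List (Fin (d - 1) → ℕ)}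
    {T : (Fin (d - 1) → ℕ) → ℝ} (h : (searchLines y δ lam α l B (a :: as)).2 = some T) :
    ∃ T' τ, (searchLines y δ lam α l B as).2 = some T' ∧
      (searchLine y δ lam α l a (B - (searchLines y δ lam α l B as).1)).2 = some τ ∧
      Function.update T' a τ = T := by
  rcases hE : (searchLines y δ lam α l B as).2 with _ | T'
  · rw [searchLines_cons_of_none y δ lam α hE, hE] at h; exact absurd h (by simp)
  · rw [searchLines_cons_of_some y δ lam α hE] at h
    obtain ⟨τ, h1, h2⟩ := Option.map_eq_some_iff.1 h
    exact ⟨T', τ, rfl, h1, h2⟩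

theorem searchLines_fst_le (l B : ℕ) (as : List (Fin (d - 1) → ℕ)) :
    (searchLines y δ lam α l B as).1 ≤ B := by
  induction as with
  | nil => simp [searchLines]
  | cons a as ih =>
    rcases hE : (searchLines y δ lam α l B as).2 with _ | T
    · rwa [searchLines_cons_of_none y δ lam α hE]
    · rw [searchLines_cons_of_some y δ lam α hE]
      have : (searchLine y δ lam α l a (B - (searchLines y δ lam α l B as).1)).1
        ≤ B - (searchLines y δ lam α l B as).1 := lineSearch_fst_le _ _ _ _
      dsimp only
      omega

theorem exists_searchLine_of_searchLines {l B : ℕ} {as : List (Fin (d - 1) → ℕ)}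
    {T : (Fin (d - 1) → ℕ) → ℝ} (h : (searchLines y δ lam α l B as).2 = some T)
    {a : Fin (d - 1) → ℕ} (ha : a ∈ as) :
    ∃ B', (searchLine y δ lam α l a B').2 = some (T a) := by
  induction as generalizing T with
  | nil => simp at ha
  | cons b as ih =>
    obtain ⟨T', τ, hT', hτ, rfl⟩ := searchLines_cons_eq_some y δ lam α h
    by_cases hab : a = b
    · subst hab
      exact ⟨_, by rw [Function.update_self]; exact hτ⟩
    · rw [Function.update_of_ne hab]
      exact ih hT' ((List.mem_cons.1 ha).resolve_left hab)

theorem searchLines_pos {l B : ℕ} {as : List (Fin (d - 1) → ℕ)} (has : as ≠ [])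
    {T : (Fin (d - 1) → ℕ) → ℝ} (hε : 0 < numEpochs (precision lam α l))
    (h : (searchLines y δ lam α l B as).2 = some T) : 1 ≤ (searchLines y δ lam α l B as).1 := by
  cases as with
  | nil => exact absurd rfl has
  | cons a as =>
    obtain ⟨T', τ, hT', hτ, -⟩ := searchLines_cons_eq_some y δ lam α h
    rw [searchLines_cons_of_some y δ lam α hT']
    have := lineSearch_pos hε hτ
    dsimp only [searchLine] at this ⊢
    omega

theorem searchLines_terminates {l B C : ℕ} {as : List (Fin (d - 1) → ℕ)}
    (hline : ∀ a ∈ as, ∀ B', C ≤ B' →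
      ∃ τ, (searchLine y δ lam α l a B').2 = some τ ∧ (searchLine y δ lam α l a B').1 ≤ C)
    (hB : as.length * C ≤ B) :
    ∃ T, (searchLines y δ lam α l B as).2 = some T ∧
      (searchLines y δ lam α l B as).1 ≤ as.length * C := by
  induction as with
  | nil => exact ⟨0, rfl, by simp [searchLines]⟩
  | cons a as ih =>
    rw [List.length_cons, Nat.succ_mul] at hB ⊢
    obtain ⟨T, hT, hc⟩ := ih (fun b hb => hline b (List.mem_cons_of_mem _ hb)) (by omega)
    rw [searchLines_cons_of_some y δ lam α hT]
    obtain ⟨τ, hτ, hc'⟩ := hline a List.mem_cons_self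
      (B - (searchLines y δ lam α l B as).1) (by omega)
    exact ⟨Function.update T a τ, by simp [hτ], by dsimp only; omega⟩

theorem mainLoop_succ_of_some {l : ℕ} {T : (Fin (d - 1) → ℕ) → ℝ}
    (h : (mainLoop y n δ lam α l).2 = some T) (hlt : (mainLoop y n δ lam α l).1 < n) :
    mainLoop y n δ lam α (l + 1) =
      ((mainLoop y n δ lam α l).1 + (searchLines y δ lam α (l + 1)
          (n - (mainLoop y n δ lam α l).1) (lineIndices d α (l + 1)).toList).1,
        (searchLines y δ lam α (l + 1)
          (n - (mainLoop y n δ lam α l).1) (lineIndices d α (l + 1)).toList).2) := by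
  rw [mainLoop]
  rcases hE : mainLoop y n δ lam α l with ⟨N, _ | J⟩
  · rw [hE] at h; exact absurd h (by simp)
  · rw [hE] at hlt
    dsimp only at hlt ⊢
    rw [if_pos hlt]

theorem mainLoop_succ_of_not {l : ℕ}
    (h : (mainLoop y n δ lam α l).2 = none ∨ ¬ (mainLoop y n δ lam α l).1 < n) :
    mainLoop y n δ lam α (l + 1) = ((mainLoop y n δ lam α l).1, none) := by
  rw [mainLoop]
  rcases hE : mainLoop y n δ lam α l with ⟨N, _ | J⟩
  · rfl
  · rw [hE] at h
    have h' : ¬ N < n := h.resolve_left (by simp)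
    dsimp only
    rw [if_neg h']

theorem mainLoop_succ_eq_some {l : ℕ} {T : (Fin (d - 1) → ℕ) → ℝ}
    (h : (mainLoop y n δ lam α (l + 1)).2 = some T) :
    (mainLoop y n δ lam α l).2.isSome ∧ (mainLoop y n δ lam α l).1 < n ∧
      (searchLines y δ lam α (l + 1)
          (n - (mainLoop y n δ lam α l).1) (lineIndices d α (l + 1)).toList).2 = some T := by
  by_cases hc : (mainLoop y n δ lam α l).2 = none ∨ ¬ (mainLoop y n δ lam α l).1 < n
  · rw [mainLoop_succ_of_not y n δ lam α hc] at h; exact absurd h (by simp)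
  · push Not at hc
    obtain ⟨T', hT'⟩ := Option.ne_none_iff_exists'.1 hc.1
    rw [mainLoop_succ_of_some y n δ lam α hT' hc.2] at h
    exact ⟨by rw [hT']; rfl, hc.2, h⟩

theorem mainLoop_fst_le (l : ℕ) : (mainLoop y n δ lam α l).1 ≤ n := by
  induction l with
  | zero => simp [mainLoop]
  | succ l ih =>
    by_cases hc : (mainLoop y n δ lam α l).2 = none ∨ ¬ (mainLoop y n δ lam α l).1 < n
    · rw [mainLoop_succ_of_not y n δ lam α hc]; exact ih
    · push Not at hc
      obtain ⟨T', hT'⟩ := Option.ne_none_iff_exists'.1 hc.1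
      rw [mainLoop_succ_of_some y n δ lam α hT' hc.2]
      have := searchLines_fst_le y δ lam α (l + 1)
          (n - (mainLoop y n δ lam α l).1) (lineIndices d α (l + 1)).toList
      dsimp only
      omega

theorem lineIndices_toList_ne_nil (l : ℕ) : (lineIndices d α l).toList ≠ [] := by
  rw [Ne, Finset.toList_eq_nil]
  refine Finset.Nonempty.ne_empty ⟨0, ?_⟩
  simp [lineIndices, Fintype.mem_piFinset]

theorem exists_searchLine_of_mainLoop {l : ℕ} (hl : 1 ≤ l) {T : (Fin (d - 1) → ℕ) → ℝ}
    (h : (mainLoop y n δ lam α l).2 = some T) {a : Fin (d - 1) → ℕ}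
    (ha : a ∈ lineIndices d α l) : ∃ B', (searchLine y δ lam α l a B').2 = some (T a) := by
  obtain ⟨l, rfl⟩ := Nat.exists_eq_add_of_le' hl
  exact exists_searchLine_of_searchLines y δ lam α (mainLoop_succ_eq_some y n δ lam α h).2.2
    (Finset.mem_toList.2 ha)

theorem card_lineIndices (l : ℕ) : (lineIndices d α l).card = (gridSize α l + 1) ^ (d - 1) := by
  simp [lineIndices, Fintype.card_piFinset]

/-- The inequality with `n` is strict because a new depth is begun only if some budget is left. -/
theorem mainLoop_terminates {L : ℕ} {C : ℕ → ℕ}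
    (hline : ∀ l, 1 ≤ l → l ≤ L → ∀ a ∈ lineIndices d α l, ∀ B', C l ≤ B' →
      ∃ τ, (searchLine y δ lam α l a B').2 = some τ ∧ (searchLine y δ lam α l a B').1 ≤ C l)
    (hn : ∑ l ∈ Finset.range L, (gridSize α (l + 1) + 1) ^ (d - 1) * C (l + 1) < n)
    {l : ℕ} (hl : l ≤ L) :
    (mainLoop y n δ lam α l).2.isSome ∧ (mainLoop y n δ lam α l).1
      ≤ ∑ i ∈ Finset.range l, (gridSize α (i + 1) + 1) ^ (d - 1) * C (i + 1) := by
  induction l with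
  | zero => simp [mainLoop]
  | succ l ih =>
    obtain ⟨hs, hc⟩ := ih (Nat.le_of_succ_le hl)
    obtain ⟨T, hT⟩ := Option.isSome_iff_exists.1 hs
    have hsum : ∑ i ∈ Finset.range (l + 1), (gridSize α (i + 1) + 1) ^ (d - 1) * C (i + 1) < n :=
      lt_of_le_of_lt (Finset.sum_le_sum_of_subset (Finset.range_mono hl)) hn
    rw [Finset.sum_range_succ] at hsum ⊢
    rw [mainLoop_succ_of_some y n δ lam α hT (by omega)]
    have hlen : (lineIndices d α (l + 1)).toList.length = (gridSize α (l + 1) + 1) ^ (d - 1) := by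
      rw [Finset.length_toList, card_lineIndices]
    obtain ⟨T', hT', hc'⟩ := searchLines_terminates y δ lam α (l := l + 1) (C := C (l + 1))
      (B := n - (mainLoop y n δ lam α l).1) (as := (lineIndices d α (l + 1)).toList)
      (fun a ha => hline (l + 1) (Nat.succ_pos l) hl a (Finset.mem_toList.1 ha))
      (by rw [hlen]; omega)
    rw [hlen] at hc'
    exact ⟨by rw [hT']; rfl, by dsimp only; omega⟩

/-- Depths with precision at least `1/2` run no epoch and cost nothing; there are finitely many. -/
theorem numEpochs_precision_pos {lam α : ℝ} (hlam : 0 < lam) (hα : 0 < α) :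
    ∃ l₀, ∀ l, l₀ ≤ l → 0 < numEpochs (precision lam α l) := by
  have h : Filter.Tendsto (fun l : ℕ => lam * ((2 : ℝ) ^ (-α)) ^ l) Filter.atTop (nhds (lam * 0)) :=
    (tendsto_pow_atTop_nhds_zero_of_lt_one (by positivity)
      (Real.rpow_lt_one_of_one_lt_of_neg (by norm_num) (by linarith))).const_mul _
  rw [mul_zero] at h
  obtain ⟨l₀, hl₀⟩ := Filter.eventually_atTop.1 (h.eventually_lt_const (show (0 : ℝ) < 1 / 2 by norm_num))
  refine ⟨l₀, fun l hl => ?_⟩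
  have h1 := hl₀ l hl
  have h2 : precision lam α l = lam * ((2 : ℝ) ^ (-α)) ^ l := by
    rw [precision, ← Real.rpow_natCast, ← Real.rpow_mul (by norm_num)]
    congr 2; ring
  rw [← h2] at h1
  have h3 : 0 < precision lam α l := by unfold precision; positivity
  rw [numEpochs, Nat.ceil_pos]
  refine Real.logb_pos (by norm_num) ?_
  rw [lt_div_iff₀ (by positivity)]
  linarith

theorem isSome_mainLoop_of_le {l l' : ℕ} (hle : l ≤ l') (h : (mainLoop y n δ lam α l').2.isSome) :
    (mainLoop y n δ lam α l).2.isSome := by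
  induction l', hle using Nat.le_induction with
  | base => exact h
  | succ l' _ ih =>
    obtain ⟨T, hT⟩ := Option.isSome_iff_exists.1 h
    exact ih (mainLoop_succ_eq_some y n δ lam α hT).1

variable {lam α} in
-- `finalDepth` is a supremum in `ℕ`, which would be the default value `0` for an unbounded set.
-- From some depth on, every completed depth costs at least one label.
theorem bddAbove_completedDepths (hlam : 0 < lam) (hα : 0 < α) :
    BddAbove {l | (mainLoop y n δ lam α l).2.isSome} := by
  obtain ⟨l₀, hl₀⟩ := numEpochs_precision_pos hlam hα
  have key : ∀ j, (mainLoop y n δ lam α (l₀ + j)).2.isSome →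
      j ≤ (mainLoop y n δ lam α (l₀ + j)).1 := by
    intro j
    induction j with
    | zero => simp
    | succ j ih =>
      intro h
      obtain ⟨T, hT⟩ := Option.isSome_iff_exists.1 h
      obtain ⟨h1, h2, h3⟩ := mainLoop_succ_eq_some y n δ lam α (l := l₀ + j) hT
      obtain ⟨T', hT'⟩ := Option.isSome_iff_exists.1 h1
      have h4 := ih h1
      have h5 := searchLines_pos y δ lam α (lineIndices_toList_ne_nil α (l₀ + j + 1))
        (hl₀ _ (by omega)) h3
      rw [← add_assoc, mainLoop_succ_of_some y n δ lam α hT' h2]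
      dsimp only
      omega
  refine ⟨l₀ + n, fun l hl => ?_⟩
  by_contra hcon
  push Not at hcon
  have h1 := isSome_mainLoop_of_le y n δ lam α (l := l₀ + (n + 1)) (by omega) hl
  have h2 := key _ h1
  have h3 := mainLoop_fst_le y n δ lam α (l₀ + (n + 1))
  omega

variable {lam α} in
theorem isSome_mainLoop_finalDepth (hlam : 0 < lam) (hα : 0 < α) :
    (mainLoop y n δ lam α (finalDepth y n δ lam α)).2.isSome :=
  Nat.sSup_mem (s := {l | (mainLoop y n δ lam α l).2.isSome}) ⟨0, rfl⟩
    (bddAbove_completedDepths y n δ hlam hα)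

variable {lam α} in
theorem le_finalDepth (hlam : 0 < lam) (hα : 0 < α) {l : ℕ}
    (h : (mainLoop y n δ lam α l).2.isSome) : l ≤ finalDepth y n δ lam α :=
  le_csSup (bddAbove_completedDepths y n δ hlam hα) h

variable {lam α} in
theorem mainLoop_finalDepth_eq (hlam : 0 < lam) (hα : 0 < α) :
    (mainLoop y n δ lam α (finalDepth y n δ lam α)).2 = some (thresholds y n δ lam α) := by
  obtain ⟨T, hT⟩ := Option.isSome_iff_exists.1 (isSome_mainLoop_finalDepth y n δ hlam hα)
  rw [thresholds, hT]; rfl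

end MainLoop

/-! ### Deviation bounds -/

section Deviation

variable {Ω : Type*} [MeasurableSpace Ω] {μ : Measure Ω} [IsProbabilityMeasure μ]

theorem conf_nonneg (δ : ℝ) (t : ℕ) : 0 ≤ conf δ t := by unfold conf; positivity

/-- The factor `2` in `conf` makes the Hoeffding exponent `4 log (δ / t)`, whence the fourth power.
-/
theorem exp_conf {δ : ℝ} (hδ : 0 < δ) (hδ1 : δ ≤ 1) {t : ℕ} (ht : 1 ≤ t) :
    Real.exp (-(t * conf δ t) ^ 2 / (2 * t * (1 / 2) ^ 2)) = (δ / t) ^ 4 := by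
  have ht' : (1 : ℝ) ≤ t := by exact_mod_cast ht
  have hpos : (0 : ℝ) < t := by linarith
  have hlog : 0 ≤ Real.log (t / δ) :=
    Real.log_nonneg (by rw [le_div_iff₀ hδ]; linarith)
  have hsq : conf δ t ^ 2 = 4 * (Real.log (t / δ) / (2 * t)) := by
    unfold conf
    rw [mul_pow, Real.sq_sqrt (by positivity)]; norm_num
  have e : -(t * conf δ t) ^ 2 / (2 * t * (1 / 2) ^ 2) = ((4 : ℕ) : ℝ) * Real.log (δ / t) := by
    rw [mul_pow, hsq, ← inv_div (t : ℝ) δ, Real.log_inv]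
    field_simp
    ring
  rw [e, Real.exp_nat_mul, Real.exp_log (by positivity)]

/-- Hoeffding's inequality for the confidence term `conf`. -/
theorem measure_conf_le_abs_empMean_sub {Y : ℕ → Ω → Bool} (hm : ∀ i, Measurable (Y i))
    (hi : iIndepFun Y μ) {p : ℝ} (hp : 0 ≤ p)
    (hlaw : ∀ i, μ {ω | Y i ω = true} = ENNReal.ofReal p) {δ : ℝ} (hδ : 0 < δ) (hδ1 : δ ≤ 1)
    {t : ℕ} (ht : 1 ≤ t) :
    μ {ω | conf δ t ≤ |empMean (fun i => Y i ω) t - p|} ≤ ENNReal.ofReal (2 * (δ / t) ^ 4) := by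
  have hpos : (0 : ℝ) < t := by exact_mod_cast ht
  set φ : Bool → ℝ := fun b => if b then 1 else 0 with hφ
  have hφm : Measurable φ := measurable_of_countable _
  have hXm : ∀ i, Measurable fun ω => φ (Y i ω) := fun i => hφm.comp (hm i)
  have hint : ∀ i, ∫ ω, φ (Y i ω) ∂μ = p := by
    intro i
    have hset : MeasurableSet {ω | Y i ω = true} := hm i (measurableSet_singleton true)
    have : (fun ω => φ (Y i ω)) = Set.indicator {ω | Y i ω = true} (fun _ => (1 : ℝ)) := by
      ext ω
      by_cases h : Y i ω = true <;> simp [φ, h]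
    rw [this, integral_indicator_const _ hset, Measure.real, hlaw, ENNReal.toReal_ofReal hp]
    simp
  have hsub : ∀ i, HasSubgaussianMGF (fun ω => φ (Y i ω) - p) ((1 / 2) ^ 2) μ := by
    intro i
    have h := hasSubgaussianMGF_of_mem_Icc (μ := μ) (a := 0) (b := 1) (hXm i).aemeasurable
      (Filter.Eventually.of_forall fun ω => by
        by_cases h : Y i ω = true <;> simp [φ, h])
    rw [hint i] at h
    simpa using h
  have hind : iIndepFun (fun i ω => φ (Y i ω) - p) μ :=
    hi.comp (fun _ b => φ b - p) fun _ => measurable_of_countable _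
  have hind' : iIndepFun (fun i ω => -(φ (Y i ω) - p)) μ :=
    hi.comp (fun _ b => -(φ b - p)) fun _ => measurable_of_countable _
  have hε : 0 ≤ t * conf δ t := mul_nonneg hpos.le (conf_nonneg δ t)
  have h1 := HasSubgaussianMGF.measure_sum_range_ge_le_of_iIndepFun hind (n := t)
    (fun i _ => hsub i) hε
  have h2 := HasSubgaussianMGF.measure_sum_range_ge_le_of_iIndepFun hind' (n := t)
    (fun i _ => (hsub i).neg) hε
  have hcast : (((1 / 2 : NNReal) ^ 2 : NNReal) : ℝ) = (1 / 2) ^ 2 := by norm_num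
  rw [hcast, exp_conf hδ hδ1 ht] at h1 h2
  have hmean : ∀ ω, t * (empMean (fun i => Y i ω) t - p)
      = ∑ i ∈ Finset.range t, (φ (Y i ω) - p) := by
    intro ω
    rw [Finset.sum_sub_distrib, empMean]
    simp only [Finset.sum_const, Finset.card_range, nsmul_eq_mul, φ]
    field_simp
  have hcover : {ω | conf δ t ≤ |empMean (fun i => Y i ω) t - p|} ⊆
      {ω | t * conf δ t ≤ ∑ i ∈ Finset.range t, (φ (Y i ω) - p)} ∪
      {ω | t * conf δ t ≤ ∑ i ∈ Finset.range t, -(φ (Y i ω) - p)} := by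
    intro ω hω
    simp only [Set.mem_ofPred_eq, Set.mem_union] at hω ⊢
    rw [Finset.sum_neg_distrib, ← hmean]
    rcases le_abs.1 hω with h | h
    · left; exact mul_le_mul_of_nonneg_left h hpos.le
    · right; rw [← mul_neg]; exact mul_le_mul_of_nonneg_left h hpos.le
  refine (measure_mono hcover).trans ((measure_union_le _ _).trans ?_)
  rw [two_mul, ENNReal.ofReal_add (by positivity) (by positivity)]
  refine add_le_add ?_ ?_
  · rw [← ENNReal.ofReal_toReal (measure_ne_top μ _)]
    exact ENNReal.ofReal_le_ofReal h1
  · rw [← ENNReal.ofReal_toReal (measure_ne_top μ _)]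
    exact ENNReal.ofReal_le_ofReal h2

/-- Telescoping: the term `1 / (N + 1) ^ 4` is at most `2 / (N + 1) - 2 / (N + 2)`. -/
theorem sum_range_inv_pow_four_le (N : ℕ) :
    ∑ t ∈ Finset.range N, (1 / ((t : ℝ) + 1)) ^ 4 ≤ 2 - 2 / ((N : ℝ) + 1) := by
  induction N with
  | zero => simp
  | succ N ih =>
    rw [Finset.sum_range_succ]
    have hN : (0 : ℝ) ≤ N := Nat.cast_nonneg N
    have h : (1 / ((N : ℝ) + 1)) ^ 4 ≤ 2 / ((N : ℝ) + 1) - 2 / ((N : ℝ) + 1 + 1) := by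
      rw [div_sub_div _ _ (by positivity) (by positivity), div_pow, one_pow,
        div_le_div_iff₀ (by positivity) (by positivity)]
      have : 0 ≤ ((N : ℝ) + 1) * (2 * ((N : ℝ) + 1) ^ 3 - (N + 2)) := by
        refine mul_nonneg (by positivity) ?_
        nlinarith [mul_nonneg hN hN, mul_nonneg (mul_nonneg hN hN) hN]
      nlinarith
    push_cast
    linarith

theorem measure_exists_conf_le {Y : ℕ → Ω → Bool} (hm : ∀ i, Measurable (Y i))
    (hi : iIndepFun Y μ) {p : ℝ} (hp : 0 ≤ p)
    (hlaw : ∀ i, μ {ω | Y i ω = true} = ENNReal.ofReal p) {δ : ℝ} (hδ : 0 < δ) (hδ1 : δ ≤ 1) :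
    μ {ω | ∃ t, 1 ≤ t ∧ conf δ t ≤ |empMean (fun i => Y i ω) t - p|}
      ≤ ENNReal.ofReal (4 * δ ^ 4) := by
  have hcover : {ω | ∃ t, 1 ≤ t ∧ conf δ t ≤ |empMean (fun i => Y i ω) t - p|} ⊆
      ⋃ t : ℕ, {ω | conf δ (t + 1) ≤ |empMean (fun i => Y i ω) (t + 1) - p|} := by
    rintro ω ⟨t, ht, h⟩
    obtain ⟨s, rfl⟩ := Nat.exists_eq_add_of_le' ht
    exact Set.mem_iUnion.2 ⟨s, h⟩
  refine (measure_mono hcover).trans ((measure_iUnion_le _).trans ?_)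
  refine ENNReal.tsum_le_of_sum_range_le fun N => ?_
  refine (Finset.sum_le_sum fun t _ => measure_conf_le_abs_empMean_sub hm hi hp hlaw hδ hδ1
    (Nat.succ_pos t)).trans ?_
  rw [← ENNReal.ofReal_sum_of_nonneg fun _ _ => by positivity]
  refine ENNReal.ofReal_le_ofReal ?_
  have e : ∀ t : ℕ, 2 * (δ / ((t + 1 : ℕ) : ℝ)) ^ 4 = 2 * δ ^ 4 * (1 / ((t : ℝ) + 1)) ^ 4 := by
    intro t; push_cast; rw [div_pow, div_pow, one_pow]; ring
  simp only [Nat.succ_eq_add_one, e]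
  rw [← Finset.mul_sum]
  have h1 := sum_range_inv_pow_four_le N
  have h2 : 0 ≤ 2 / ((N : ℝ) + 1) := by positivity
  have h3 : 0 < δ ^ 4 := by positivity
  nlinarith

/-- The weight of epoch `k` combines `3 ^ k` intervals, `3` points on each, and failure probability
`4 δ ^ 4 / 16 ^ (k + 1)` at each point. -/
theorem sum_range_epoch_weights_le (K : ℕ) :
    ∑ k ∈ Finset.range K, (12 * 3 ^ k / 16 ^ (k + 1) : ℝ) ≤ 1 - (3 / 16) ^ K := by
  induction K with
  | zero => simp
  | succ K ih =>
    rw [Finset.sum_range_succ]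
    have e : (12 * 3 ^ K / 16 ^ (K + 1) : ℝ) = 12 / 16 * (3 / 16) ^ K := by
      rw [div_pow, pow_succ]; field_simp
    have h : (0 : ℝ) < (3 / 16) ^ K := by positivity
    rw [e, pow_succ]
    linarith

/-- Adaptivity is removed by a union over the deterministic set `reachable k`; at a fixed point the
labels are independent and identically distributed. The factor `K` in the confidence parameter is
only needed to be at least `1`. -/
theorem measure_not_lineDeviation_le {Y : ℕ → Fin 3 → ℕ → ℝ → Ω → Bool} {η : ℝ → ℝ}
    (hm : ∀ k j i z, Measurable (Y k j i z))
    (hi : ∀ k j z, iIndepFun (fun i => Y k j i z) μ)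
    (hη : ∀ z ∈ Set.Icc (0 : ℝ) 1, 0 ≤ η z)
    (hlaw : ∀ k j i, ∀ z ∈ Set.Icc (0 : ℝ) 1, μ {ω | Y k j i z ω = true} = ENNReal.ofReal (η z))
    {δ : ℝ} (hδ : 0 < δ) (hδ1 : δ ≤ 1) (K : ℕ) :
    μ {ω | ¬ LineDeviation (fun k j i z => Y k j i z ω) η δ K} ≤ ENNReal.ofReal (δ ^ 4) := by
  have hcover : {ω | ¬ LineDeviation (fun k j i z => Y k j i z ω) η δ K} ⊆
      ⋃ k ∈ Finset.range K, ⋃ I ∈ reachable k, ⋃ j ∈ (Finset.univ : Finset (Fin 3)),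
        {ω | ∃ t, 1 ≤ t ∧ conf (δ / (K * 2 ^ (k + 1))) t ≤
          |empMean (fun i => Y (k + 1) j i (quartile j I) ω) t - η (quartile j I)|} := by
    intro ω hω
    simp only [Set.mem_ofPred_eq, LineDeviation] at hω
    push Not at hω
    obtain ⟨k, hk, I, hI, j, t, ht, h⟩ := hω
    simp only [Set.mem_iUnion]
    exact ⟨k, Finset.mem_range.2 hk, I, hI, j, Finset.mem_univ j, t, ht, h⟩
  have hpoint : ∀ k ∈ Finset.range K, ∀ I ∈ reachable k, ∀ j : Fin 3,
      μ {ω | ∃ t, 1 ≤ t ∧ conf (δ / (K * 2 ^ (k + 1))) t ≤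
          |empMean (fun i => Y (k + 1) j i (quartile j I) ω) t - η (quartile j I)|}
        ≤ ENNReal.ofReal (4 * δ ^ 4 / 16 ^ (k + 1)) := by
    intro k hk I hI j
    have hz := quartile_mem hI j
    have hK : (1 : ℝ) ≤ K := by
      exact_mod_cast Nat.one_le_iff_ne_zero.2 fun h => by simp [h] at hk
    have hden : (2 : ℝ) ^ (k + 1) ≤ K * 2 ^ (k + 1) := le_mul_of_one_le_left (by positivity) hK
    have hpow : (1 : ℝ) ≤ 2 ^ (k + 1) := one_le_pow₀ (by norm_num)
    have hle : δ / (K * 2 ^ (k + 1)) ≤ δ / 2 ^ (k + 1) := by gcongr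
    have hle1 : δ / (2 : ℝ) ^ (k + 1) ≤ 1 := (div_le_one (by positivity)).2 (hδ1.trans hpow)
    refine (measure_exists_conf_le (fun i => hm (k + 1) j i _) (hi (k + 1) j _) (hη _ hz)
      (fun i => hlaw (k + 1) j i _ hz) (by positivity) (hle.trans hle1)).trans ?_
    refine ENNReal.ofReal_le_ofReal ?_
    calc 4 * (δ / (K * 2 ^ (k + 1))) ^ 4 ≤ 4 * (δ / 2 ^ (k + 1)) ^ 4 := by gcongr
      _ = 4 * δ ^ 4 / 16 ^ (k + 1) := by
        rw [div_pow, ← pow_mul, mul_comm (k + 1) 4, pow_mul]; norm_num; ring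
  refine (measure_mono hcover).trans ((measure_biUnion_finset_le _ _).trans ?_)
  calc _ ≤ ∑ k ∈ Finset.range K, ENNReal.ofReal (δ ^ 4 * (12 * 3 ^ k / 16 ^ (k + 1))) := by
        refine Finset.sum_le_sum fun k hk => (measure_biUnion_finset_le _ _).trans ?_
        refine (Finset.sum_le_sum fun I hI => (measure_biUnion_finset_le _ _).trans
          (Finset.sum_le_sum fun j _ => hpoint k hk I hI j)).trans ?_
        simp only [Finset.sum_const, Finset.card_univ, Fintype.card_fin, nsmul_eq_mul]
        have hc : ((reachable k).card : ENNReal) ≤ ENNReal.ofReal (3 ^ k) := by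
          rw [← ENNReal.ofReal_natCast]
          exact ENNReal.ofReal_le_ofReal (by exact_mod_cast card_reachable_le k)
        have h3 : ((3 : ℕ) : ENNReal) = ENNReal.ofReal 3 := by simp
        rw [h3, ← ENNReal.ofReal_mul (by norm_num)]
        refine (mul_le_mul_left hc _).trans ?_
        rw [← ENNReal.ofReal_mul (by positivity)]
        exact ENNReal.ofReal_le_ofReal (le_of_eq (by ring))
    _ = ENNReal.ofReal (δ ^ 4 * ∑ k ∈ Finset.range K, (12 * 3 ^ k / 16 ^ (k + 1) : ℝ)) := by
        rw [Finset.mul_sum, ENNReal.ofReal_sum_of_nonneg fun _ _ => by positivity]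
    _ ≤ _ := by
        refine ENNReal.ofReal_le_ofReal (mul_le_of_le_one_right (by positivity) ?_)
        have := sum_range_epoch_weights_le K
        have h : (0 : ℝ) < (3 / 16) ^ K := by positivity
        linarith

end Deviation

/-! ### The favourable event -/

/-- Confidence parameter of the deviation bounds at depth `l`. While `2 ^ (l + 1) ≤ ⌈α⌉` there are
too many lines for a union bound at level `depthConf`; the algorithm returns nothing at such
depths, and only their cost has to be controlled. -/
noncomputable def levelConf (d : ℕ) (δ α : ℝ) (l : ℕ) : ℝ :=
  if 2 ^ (l + 1) ≤ ⌈α⌉₊ then depthConf d δ α l / (cellNodes α : ℝ) ^ d else depthConf d δ α l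

/-- All empirical means that the procedure may compute are within the confidence terms. -/
def AllDeviation {d : ℕ} (P : ClassificationProblem d) (δ lam α : ℝ)
    (y : Request d → Point d → Bool) : Prop :=
  ∀ l, 1 ≤ l → ∀ a ∈ lineIndices d α l,
    LineDeviation (fun k j i z => y ⟨l, a, k, j, i⟩ (gridPoint α l a, z))
      (fun z => P.eta (gridPoint α l a, z)) (levelConf d δ α l) (numEpochs (precision lam α l))

theorem depthConf_pos (d : ℕ) {δ : ℝ} (hδ : 0 < δ) (α : ℝ) (l : ℕ) : 0 < depthConf d δ α l := by
  have : (0 : ℝ) < cellNodes α := by exact_mod_cast one_le_cellNodes α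
  unfold depthConf
  positivity

theorem levelConf_pos (d : ℕ) {δ : ℝ} (hδ : 0 < δ) (α : ℝ) (l : ℕ) : 0 < levelConf d δ α l := by
  have : (0 : ℝ) < cellNodes α := by exact_mod_cast one_le_cellNodes α
  have := depthConf_pos d hδ α l
  unfold levelConf
  split_ifs <;> positivity

theorem levelConf_le_depthConf (d : ℕ) {δ : ℝ} (hδ : 0 < δ) (α : ℝ) (l : ℕ) :
    levelConf d δ α l ≤ depthConf d δ α l := by
  have h1 : (1 : ℝ) ≤ cellNodes α := by exact_mod_cast one_le_cellNodes α
  unfold levelConf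
  split_ifs
  · exact div_le_self (depthConf_pos d hδ α l).le (one_le_pow₀ h1)
  · rfl

theorem le_levelConf (d : ℕ) {δ : ℝ} (hδ : 0 < δ) (α : ℝ) (l : ℕ) :
    depthConf d δ α l / (cellNodes α : ℝ) ^ d ≤ levelConf d δ α l := by
  have h1 : (1 : ℝ) ≤ cellNodes α := by exact_mod_cast one_le_cellNodes α
  unfold levelConf
  split_ifs
  · rfl
  · exact div_le_self (depthConf_pos d hδ α l).le (one_le_pow₀ h1)

theorem depthConf_le (d : ℕ) {δ : ℝ} (hδ : 0 < δ) (α : ℝ) (l : ℕ) : depthConf d δ α l ≤ δ := by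
  have h1 : (1 : ℝ) ≤ cellNodes α := by exact_mod_cast one_le_cellNodes α
  have h2 : (1 : ℝ) ≤ 2 ^ (l * (d + 1)) := one_le_pow₀ (by norm_num)
  exact div_le_self hδ.le (one_le_mul_of_one_le_of_one_le h1 h2)

theorem cellNodes_le_ceil {α : ℝ} (hα : 0 < α) : cellNodes α ≤ ⌈α⌉₊ := by
  have := Nat.ceil_pos.2 hα
  rw [cellNodes, strictFloor]
  omega

/-- The fourth power must absorb `m ^ (d - 1)` from the number of lines. If `2 ^ (l + 1) > ⌈α⌉`,
then `m ≤ 4 ^ l` and the powers of `2 ^ l` in `depthConf` suffice; otherwise the extra `m ^ d` in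
`levelConf` does it. -/
theorem card_mul_levelConf_pow_le {d : ℕ} (hd : 1 ≤ d) {δ α : ℝ} (hδ : 0 < δ) (hδ1 : δ ≤ 1)
    (hα : 0 < α) {l : ℕ} (hl : 1 ≤ l) :
    ((gridSize α l : ℝ) + 1) ^ (d - 1) * levelConf d δ α l ^ 4 ≤ δ / 2 ^ l := by
  obtain ⟨e, rfl⟩ := Nat.exists_eq_add_of_le' hd
  rw [Nat.add_sub_cancel]
  set m : ℝ := (cellNodes α : ℝ) with hmdef
  have hm : (1 : ℝ) ≤ m := by rw [hmdef]; exact_mod_cast one_le_cellNodes α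
  set x : ℝ := 2 ^ l with hx
  have hx2 : (2 : ℝ) ≤ x := by
    calc (2 : ℝ) = 2 ^ 1 := by norm_num
      _ ≤ 2 ^ l := pow_le_pow_right₀ (by norm_num) hl
  have hgrid : (gridSize α l : ℝ) = m * x := by rw [gridSize]; push_cast; rfl
  have hN : ((gridSize α l : ℝ) + 1) ^ e ≤ (m * x ^ 2) ^ e := by
    rw [hgrid]
    gcongr
    nlinarith [mul_nonneg (sub_nonneg.2 hm) (sub_nonneg.2 hx2)]
  have hdc : depthConf (e + 1) δ α l = δ / (m * x ^ (e + 2)) := by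
    rw [depthConf, hx, ← pow_mul]
  have hδ4 : δ ^ 4 ≤ δ := pow_le_of_le_one hδ.le hδ1 (by norm_num)
  have hkey : (m * x ^ 2) ^ e * levelConf (e + 1) δ α l ^ 4 ≤ δ ^ 4 / x := by
    unfold levelConf
    split_ifs with hlow
    · rw [hdc, div_div, div_pow, ← mul_div_assoc,
        div_le_div_iff₀ (by positivity) (by positivity)]
      have h1 : (m * x ^ 2) ^ e * x ≤ (m * x ^ (e + 2) * m ^ (e + 1)) ^ 4 := by
        calc (m * x ^ 2) ^ e * x = m ^ e * x ^ (2 * e + 1) := by ring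
          _ ≤ m ^ (4 * (e + 2)) * x ^ (4 * (e + 2)) := by
            gcongr <;> linarith
          _ = _ := by ring
      nlinarith [pow_pos hδ 4]
    · have hmx : m ≤ x ^ 2 := by
        have h1 := cellNodes_le_ceil hα
        have h2 : cellNodes α ≤ 2 ^ (l + 1) := by omega
        calc m ≤ 2 ^ (l + 1) := by rw [hmdef]; exact_mod_cast h2
          _ = x * 2 := by rw [pow_succ]
          _ ≤ x ^ 2 := by nlinarith
      rw [hdc, div_pow, ← mul_div_assoc, div_le_div_iff₀ (by positivity) (by positivity)]
      have h1 : (m * x ^ 2) ^ e * x ≤ (m * x ^ (e + 2)) ^ 4 := by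
        calc (m * x ^ 2) ^ e * x ≤ (x ^ 2 * x ^ 2) ^ e * x := by gcongr
          _ = 1 * x ^ (4 * e + 1) := by ring
          _ ≤ m ^ 4 * x ^ (4 * (e + 2)) := by
            gcongr
            · exact one_le_pow₀ hm
            · linarith
            · omega
          _ = _ := by ring
      nlinarith [pow_pos hδ 4]
  calc _ ≤ (m * x ^ 2) ^ e * levelConf (e + 1) δ α l ^ 4 := by gcongr
    _ ≤ δ ^ 4 / x := hkey
    _ ≤ δ / x := by gcongr

theorem measure_not_allDeviation_le {d : ℕ} (hd : 1 ≤ d) {δ lam α : ℝ} (hδ : 0 < δ)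
    (hδ1 : δ ≤ 1) (hα : 0 < α) {P : ClassificationProblem d} {Ω : Type*} [MeasurableSpace Ω]
    {μ : Measure Ω} [IsProbabilityMeasure μ] {Y : Request d → Point d → Ω → Bool}
    (hY : IsLabelOracle P μ Y) :
    μ {ω | ¬ AllDeviation P δ lam α (fun r x => Y r x ω)} ≤ ENNReal.ofReal δ := by
  have hcover : {ω | ¬ AllDeviation P δ lam α (fun r x => Y r x ω)} ⊆
      ⋃ l : ℕ, ⋃ a ∈ lineIndices d α (l + 1), {ω | ¬ LineDeviation
        (fun k j i z => Y ⟨l + 1, a, k, j, i⟩ (gridPoint α (l + 1) a, z) ω)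
        (fun z => P.eta (gridPoint α (l + 1) a, z)) (levelConf d δ α (l + 1))
        (numEpochs (precision lam α (l + 1)))} := by
    intro ω hω
    simp only [Set.mem_ofPred_eq, AllDeviation] at hω
    push Not at hω
    obtain ⟨l, hl, a, ha, h⟩ := hω
    obtain ⟨l, rfl⟩ := Nat.exists_eq_add_of_le' hl
    simp only [Set.mem_iUnion]
    exact ⟨l, a, ha, h⟩
  refine (measure_mono hcover).trans ((measure_iUnion_le _).trans ?_)
  have hlevel : ∀ l : ℕ, μ (⋃ a ∈ lineIndices d α (l + 1), {ω | ¬ LineDeviation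
        (fun k j i z => Y ⟨l + 1, a, k, j, i⟩ (gridPoint α (l + 1) a, z) ω)
        (fun z => P.eta (gridPoint α (l + 1) a, z)) (levelConf d δ α (l + 1))
        (numEpochs (precision lam α (l + 1)))}) ≤ ENNReal.ofReal (δ / 2 / 2 ^ l) := by
    intro l
    refine (measure_biUnion_finset_le _ _).trans ?_
    refine (Finset.sum_le_sum fun a ha => measure_not_lineDeviation_le
      (Y := fun k j i z => Y ⟨l + 1, a, k, j, i⟩ (gridPoint α (l + 1) a, z))
      (fun k j i z => hY.measurable _ _) (fun k j z => ?_) (fun z hz => ?_)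
      (fun k j i z hz => ?_) (levelConf_pos d hδ α (l + 1))
      (((levelConf_le_depthConf d hδ α _).trans (depthConf_le d hδ α _)).trans hδ1) _).trans ?_
    -- Along a fixed epoch and quartile only the round varies, so distinct rounds are distinct
    -- requests.
    · have hinj : Function.Injective fun i : ℕ => (⟨l + 1, a, k, j, i⟩ : Request d) := by
        intro i i' h
        simpa using h
      exact (hY.indep.precomp hinj).comp (fun _ f => f (gridPoint α (l + 1) a, z))
        fun _ => measurable_pi_apply _
    · exact (P.eta_mem _ ⟨gridPoint_mem_baseCube α _ ha, hz⟩).1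
    · exact hY.law _ _ ⟨gridPoint_mem_baseCube α _ ha, hz⟩
    · rw [Finset.sum_const, card_lineIndices, nsmul_eq_mul, ← ENNReal.ofReal_natCast,
        ← ENNReal.ofReal_mul (Nat.cast_nonneg _)]
      refine ENNReal.ofReal_le_ofReal ?_
      push_cast
      refine (card_mul_levelConf_pow_le hd hδ hδ1 hα (Nat.succ_pos l)).trans (le_of_eq ?_)
      rw [pow_succ]; field_simp
  refine (ENNReal.tsum_le_tsum hlevel).trans ?_
  have hsum := tsum_geometric_two' δ
  rw [← ENNReal.ofReal_tsum_of_nonneg (fun _ => by positivity) (summable_geometric_two' δ), hsum]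

/-! ### The cost of the line searches -/

theorem precision_eq (lam α : ℝ) (l : ℕ) :
    precision lam α l = lam * (((2 : ℝ) ^ l) ^ α)⁻¹ := by
  rw [precision, Real.rpow_neg (by norm_num), Real.rpow_mul (by norm_num), Real.rpow_natCast]

theorem two_pow_numEpochs_mul_lt {ε : ℝ} (hε : 0 < ε) (hK : 0 < numEpochs ε) :
    (2 : ℝ) ^ numEpochs ε * ε < 1 := by
  have hpos : 0 < Real.logb 2 (1 / (2 * ε)) := Nat.ceil_pos.1 hK
  have h : (numEpochs ε : ℝ) < Real.logb 2 (1 / (2 * ε)) + 1 := Nat.ceil_lt_add_one hpos.le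
  have h2 : (numEpochs ε : ℝ) - 1 < Real.logb 2 (1 / (2 * ε)) := by linarith
  rw [Real.lt_logb_iff_rpow_lt (by norm_num) (by positivity), Real.rpow_sub_one (by norm_num),
    Real.rpow_natCast, div_lt_div_iff₀ (by norm_num) (by positivity)] at h2
  linarith

theorem two_pow_numEpochs_precision_lt {lam α : ℝ} (hlam : 0 < lam) {l : ℕ}
    (hK : 0 < numEpochs (precision lam α l)) :
    (2 : ℝ) ^ numEpochs (precision lam α l) * lam < ((2 : ℝ) ^ l) ^ α := by
  have hx : (0 : ℝ) < ((2 : ℝ) ^ l) ^ α := by positivity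
  have hε : 0 < precision lam α l := by rw [precision_eq]; positivity
  have h := two_pow_numEpochs_mul_lt hε hK
  generalize numEpochs (precision lam α l) = K at h
  rw [precision_eq, ← mul_assoc, ← div_eq_mul_inv, div_lt_one hx] at h
  exact h

/-- Lower bound on `|η - 1/2|` at distance `2 ^ (-k) / 8` from the boundary. -/
noncomputable def epochGap (κ c : ℝ) (k : ℕ) : ℝ := c * (((2 : ℝ) ^ k)⁻¹ / 8) ^ (κ - 1)

/-- Number of rounds that suffices in an epoch with margin `epochGap κ c k`, when `Λ` bounds the
logarithm in the confidence term. -/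
noncomputable def epochRounds (κ c Λ : ℝ) (k : ℕ) : ℕ := ⌈8 * Λ / epochGap κ c k ^ 2⌉₊

/-- Bound on the number of labels of a line search with `K` epochs. -/
noncomputable def lineCost (κ c Λ : ℝ) (K : ℕ) : ℕ :=
  ∑ k ∈ Finset.range K, 3 * epochRounds κ c Λ k

theorem epochGap_pos {κ c : ℝ} (hc : 0 < c) (k : ℕ) : 0 < epochGap κ c k := by
  unfold epochGap; positivity

theorem epochGap_le {κ c : ℝ} (hκ : 1 ≤ κ) (hc : 0 < c) (k : ℕ) : epochGap κ c k ≤ c := by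
  unfold epochGap
  refine mul_le_of_le_one_right hc.le (Real.rpow_le_one (by positivity) ?_ (by linarith))
  have h : ((2 : ℝ) ^ k)⁻¹ ≤ 1 := inv_le_one_of_one_le₀ (one_le_pow₀ (by norm_num))
  linarith

theorem inv_epochGap_sq {κ c : ℝ} (k : ℕ) :
    (epochGap κ c k ^ 2)⁻¹
      = (8 : ℝ) ^ (2 * (κ - 1)) / c ^ 2 * ((4 : ℝ) ^ (κ - 1)) ^ k := by
  have h1 : ((((2 : ℝ) ^ k)⁻¹ / 8) ^ (κ - 1)) ^ 2
      = ((8 : ℝ) ^ (2 * (κ - 1)))⁻¹ * (((4 : ℝ) ^ (κ - 1)) ^ k)⁻¹ := by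
    rw [Real.div_rpow (by positivity) (by norm_num), Real.inv_rpow (by positivity), div_pow,
      inv_pow, ← Real.rpow_natCast ((8 : ℝ) ^ (κ - 1)) 2, ← Real.rpow_mul (by norm_num),
      ← Real.rpow_natCast (((2 : ℝ) ^ k) ^ (κ - 1)) 2, ← Real.rpow_mul (by positivity),
      ← Real.rpow_natCast ((4 : ℝ) ^ (κ - 1)) k, ← Real.rpow_mul (by norm_num),
      ← Real.rpow_natCast (2 : ℝ) k, ← Real.rpow_mul (by norm_num),
      show (4 : ℝ) = 2 ^ (2 : ℝ) by norm_num, ← Real.rpow_mul (by norm_num)]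
    rw [div_eq_mul_inv, mul_comm]
    congr 3
    · rw [Nat.cast_ofNat, mul_comm]
    · push_cast; ring
  rw [epochGap, mul_pow, h1, mul_inv, mul_inv, inv_inv, inv_inv]
  ring

/-- The quotient is at least `32`, so rounding up costs less than five percent: `8.4 = 1.05 * 8`. -/
theorem epochRounds_le {κ c Λ : ℝ} (hκ : 1 ≤ κ) (hc : 0 < c) (hc' : c ≤ 1 / 2) (hΛ : 1 ≤ Λ)
    (k : ℕ) : (epochRounds κ c Λ k : ℝ)
      ≤ 8.4 * Λ * ((8 : ℝ) ^ (2 * (κ - 1)) / c ^ 2 * ((4 : ℝ) ^ (κ - 1)) ^ k) := by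
  have hg := epochGap_pos (κ := κ) hc k
  have hg1 : epochGap κ c k ^ 2 ≤ 1 / 4 := by
    have := (epochGap_le hκ hc k).trans hc'
    nlinarith
  have hx : 32 ≤ 8 * Λ / epochGap κ c k ^ 2 := by
    rw [le_div_iff₀ (by positivity)]; linarith
  rw [← inv_epochGap_sq]
  refine (Nat.ceil_lt_add_one (by linarith)).le.trans ?_
  have e : 8.4 * Λ * (epochGap κ c k ^ 2)⁻¹ = 1.05 * (8 * Λ / epochGap κ c k ^ 2) := by
    rw [div_eq_mul_inv]; ring
  rw [e]
  linarith

theorem one_le_epochRounds {κ c Λ : ℝ} (hc : 0 < c) (hΛ : 1 ≤ Λ) (k : ℕ) :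
    1 ≤ epochRounds κ c Λ k := by
  have := epochGap_pos (κ := κ) hc k
  exact Nat.ceil_pos.2 (by positivity)

theorem geom_sum_four_rpow_le {s : ℝ} (hs : 0 < s) (K : ℕ) :
    ∑ k ∈ Finset.range K, ((4 : ℝ) ^ s) ^ k ≤ ((4 : ℝ) ^ s) ^ K / (2 * s * Real.log 2) := by
  have hlog : 0 < Real.log 2 := Real.log_pos (by norm_num)
  have h1 : 2 * s * Real.log 2 ≤ (4 : ℝ) ^ s - 1 := by
    have e : (4 : ℝ) ^ s = Real.exp (2 * s * Real.log 2) := by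
      rw [Real.rpow_def_of_pos (by norm_num), show (4 : ℝ) = 2 ^ 2 by norm_num, Real.log_pow]
      congr 1; push_cast; ring
    rw [e]
    linarith [Real.add_one_le_exp (2 * s * Real.log 2)]
  have hpos : 0 < 2 * s * Real.log 2 := by positivity
  rw [geom_sum_eq (by linarith)]
  gcongr
  linarith

/-- The last epoch dominates, and `2 ^ K < 2 ^ (l α) / λ` by the choice of the number of epochs. The
constant is `3 * 8.4 / 2`, with three labels per round and the `2` from the geometric sum. -/
theorem lineCost_le {κ c Λ lam α : ℝ} (hκ : 1 < κ) (hc : 0 < c) (hc' : c ≤ 1 / 2) (hΛ : 1 ≤ Λ)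
    (hlam : 0 < lam) (l : ℕ) :
    (lineCost κ c Λ (numEpochs (precision lam α l)) : ℝ)
      ≤ 12.6 / Real.log 2 * Λ * ((8 : ℝ) ^ (2 * (κ - 1)) / (c ^ 2 * (κ - 1))) *
        lam ^ (-(2 * (κ - 1))) * ((2 : ℝ) ^ l) ^ (2 * α * (κ - 1)) := by
  have hlog : 0 < Real.log 2 := Real.log_pos (by norm_num)
  have hs : 0 < κ - 1 := by linarith
  rcases Nat.eq_zero_or_pos (numEpochs (precision lam α l)) with h0 | hpos
  · rw [h0, lineCost, Finset.range_zero, Finset.sum_empty, Nat.cast_zero]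
    positivity
  have hK := two_pow_numEpochs_precision_lt hlam hpos
  set K := numEpochs (precision lam α l)
  have h4K : ((4 : ℝ) ^ (κ - 1)) ^ K
      ≤ lam ^ (-(2 * (κ - 1))) * ((2 : ℝ) ^ l) ^ (2 * α * (κ - 1)) := by
    have e1 : ((4 : ℝ) ^ (κ - 1)) ^ K = ((2 : ℝ) ^ K) ^ (2 * (κ - 1)) := by
      rw [← Real.rpow_natCast, ← Real.rpow_natCast, ← Real.rpow_mul (by norm_num),
        ← Real.rpow_mul (by norm_num), show (4 : ℝ) = 2 ^ (2 : ℝ) by norm_num,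
        ← Real.rpow_mul (by norm_num)]
      congr 1; ring
    have e2 : ((2 : ℝ) ^ l) ^ (2 * α * (κ - 1)) = (((2 : ℝ) ^ l) ^ α) ^ (2 * (κ - 1)) := by
      rw [← Real.rpow_mul (by positivity)]; congr 1; ring
    rw [e1, e2, Real.rpow_neg hlam.le, ← div_eq_inv_mul, ← Real.div_rpow (by positivity) hlam.le]
    refine Real.rpow_le_rpow (by positivity) ?_ (by linarith)
    rw [le_div_iff₀ hlam]
    exact hK.le
  calc (lineCost κ c Λ K : ℝ)
      = ∑ k ∈ Finset.range K, 3 * (epochRounds κ c Λ k : ℝ) := by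
        rw [lineCost]; push_cast; rfl
    _ ≤ ∑ k ∈ Finset.range K, 25.2 * Λ * ((8 : ℝ) ^ (2 * (κ - 1)) / c ^ 2) *
          ((4 : ℝ) ^ (κ - 1)) ^ k := by
        refine Finset.sum_le_sum fun k _ => ?_
        have := epochRounds_le hκ.le hc hc' hΛ k
        linarith
    _ ≤ 25.2 * Λ * ((8 : ℝ) ^ (2 * (κ - 1)) / c ^ 2) *
          ((lam ^ (-(2 * (κ - 1))) * ((2 : ℝ) ^ l) ^ (2 * α * (κ - 1))) /
            (2 * (κ - 1) * Real.log 2)) := by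
        rw [← Finset.mul_sum]
        refine mul_le_mul_of_nonneg_left ((geom_sum_four_rpow_le hs K).trans ?_) (by positivity)
        gcongr
    _ = _ := by field_simp; ring

/-! ### Summation of the cost over lines and depths -/

theorem sum_range_pow_succ_le {x : ℝ} (hx : 2 ≤ x) (L : ℕ) :
    ∑ l ∈ Finset.range L, x ^ (l + 1) ≤ 2 * x ^ L := by
  induction L with
  | zero => simp
  | succ L ih =>
    rw [Finset.sum_range_succ]
    have h : 0 < x ^ L := by positivity
    have : x ^ (L + 1) = x ^ L * x := pow_succ _ _
    nlinarith

/-- As `2 ^ l ≥ 2`, the added `1` costs a factor `3/2 = 0.75 * 2` per axis. -/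
theorem gridSize_add_one_pow_le {d : ℕ} (hd : 2 ≤ d) {α : ℝ} (hα : 0 < α) {l : ℕ} (hl : 1 ≤ l) :
    ((gridSize α l : ℝ) + 1) ^ (d - 1)
      ≤ 0.75 * (2 * (⌈α⌉₊ : ℝ)) ^ (d - 1) * ((2 : ℝ) ^ l) ^ (d - 1) := by
  have hm : (cellNodes α : ℝ) ≤ ⌈α⌉₊ := by exact_mod_cast cellNodes_le_ceil hα
  have hp : (1 : ℝ) ≤ ⌈α⌉₊ := by exact_mod_cast Nat.ceil_pos.2 hα
  have hx : (2 : ℝ) ≤ 2 ^ l := by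
    calc (2 : ℝ) = 2 ^ 1 := by norm_num
      _ ≤ 2 ^ l := pow_le_pow_right₀ (by norm_num) hl
  have h1 : (gridSize α l : ℝ) + 1 ≤ 0.75 * (2 * (⌈α⌉₊ : ℝ) * 2 ^ l) := by
    rw [gridSize]; push_cast; nlinarith
  calc _ ≤ (0.75 * (2 * (⌈α⌉₊ : ℝ) * 2 ^ l)) ^ (d - 1) := by gcongr
    _ = 0.75 ^ (d - 1) * (2 * (⌈α⌉₊ : ℝ)) ^ (d - 1) * ((2 : ℝ) ^ l) ^ (d - 1) := by
      rw [mul_pow, mul_pow (2 * (⌈α⌉₊ : ℝ)), mul_assoc]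
    _ ≤ _ := by
      gcongr
      exact pow_le_of_le_one (by norm_num) (by norm_num) (by omega)

/-- `3 u + 2` times `(6/7) ^ u` is bounded. -/
theorem mul_rpow_le (u : ℝ) (hu : 0 < u) : (3 * u + 2) * (6 / 7 : ℝ) ^ u ≤ 8.6 := by
  have h1 : (6 / 7 : ℝ) ^ u ≤ Real.exp (-(u / 7)) := by
    rw [Real.rpow_def_of_pos (by norm_num)]
    refine Real.exp_le_exp.2 ?_
    have : Real.log (6 / 7) ≤ 6 / 7 - 1 := Real.log_le_sub_one_of_pos (by norm_num)
    nlinarith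
  -- This is the inequality `1 + v ≤ exp v` at `v = u / 7 - 19 / 21`, the shift for which `1 + v` is
  -- proportional to `3 u + 2`.
  have h2 : (3 * u + 2) / 21 ≤ Real.exp (u / 7 - 19 / 21) := by
    have := Real.add_one_le_exp (u / 7 - 19 / 21)
    linarith
  have h3 : (2.4590 : ℝ) ≤ Real.exp (19 / 21) := by
    have e : Real.exp (19 / 21) = Real.exp 1 * Real.exp (-(2 / 21)) := by
      rw [← Real.exp_add]; norm_num
    have h4 := Real.exp_one_gt_d9
    have h5 := Real.add_one_le_exp (-(2 / 21 : ℝ))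
    rw [e]
    nlinarith
  calc (3 * u + 2) * (6 / 7 : ℝ) ^ u
      ≤ (21 * Real.exp (u / 7 - 19 / 21)) * Real.exp (-(u / 7)) := by
        gcongr; linarith
    _ = 21 * (Real.exp (19 / 21))⁻¹ := by
        rw [mul_assoc, ← Real.exp_add, ← Real.exp_neg]; congr 2; ring
    _ ≤ 21 * (2.4590)⁻¹ := by gcongr
    _ ≤ 8.6 := by norm_num

theorem log_div_pos {n : ℕ} (hn : 1 ≤ n) {δ : ℝ} (hδ : 0 < δ) (hδ1 : δ < 1) :
    0 < Real.log (n / δ) := by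
  have hn' : (1 : ℝ) ≤ n := by exact_mod_cast hn
  exact Real.log_pos (by rw [lt_div_iff₀ hδ]; linarith)

theorem c₁_pos (d : ℕ) {α κ c : ℝ} (hα : 0 < α) (hκ : 1 < κ) (hc : 0 < c) (hc' : c ≤ 1 / 2) :
    0 < c₁ d α κ c := by
  have hs : 0 < κ - 1 := by linarith
  have hp : (0 : ℝ) < ⌈α⌉₊ := by exact_mod_cast Nat.ceil_pos.2 hα
  have hlog : 0 < Real.log (1 / c) := Real.log_pos (by rw [lt_div_iff₀ hc]; linarith)
  unfold c₁
  positivity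

theorem widthBound_nonneg (d : ℕ) {n : ℕ} (hn : 1 ≤ n) {δ lam α κ c : ℝ} (hδ : 0 < δ)
    (hδ1 : δ < 1) (hlam : 0 < lam) (hα : 0 < α) (hκ : 1 < κ) (hc : 0 < c) (hc' : c ≤ 1 / 2) :
    0 ≤ widthBound d n δ lam α κ c := by
  have := c₁_pos d hα hκ hc hc'
  have := log_div_pos hn hδ hδ1
  unfold widthBound
  positivity

/-- If `6 b_F` exceeds the width bound, then `2 ^ (F + 1)` is small. -/
theorem two_pow_rpow_mul_le {d : ℕ} (hd : 2 ≤ d) {n : ℕ} (hn : 1 ≤ n) {δ lam α κ c : ℝ}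
    (hδ : 0 < δ) (hδ1 : δ < 1) (hlam : 1 ≤ lam) (hα : 0 < α) (hκ : 1 < κ) (hc : 0 < c)
    (hc' : c ≤ 1 / 2) {F : ℕ} (hF : widthBound d n δ lam α κ c < 6 * bias d lam α F) :
    Real.log (n / δ) / (c₁ d α κ c * n) *
      (((2 : ℝ) ^ (F + 1)) ^ (2 * α * (κ - 1) + d - 1) * lam ^ (-(2 * (κ - 1))))
      ≤ (6 / 7 : ℝ) ^ (1 / α) := by
  have hc1 := c₁_pos d hα hκ hc hc'
  have hl := log_div_pos hn hδ hδ1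
  have hn' : (0 : ℝ) < n := by exact_mod_cast hn
  have hp : (0 : ℝ) < ⌈α⌉₊ := by exact_mod_cast Nat.ceil_pos.2 hα
  have hm : (1 : ℝ) ≤ cellNodes α := by exact_mod_cast one_le_cellNodes α
  have hlam0 : 0 < lam := by linarith
  have hs : 0 < κ - 1 := by linarith
  have hd' : (2 : ℝ) ≤ d := by exact_mod_cast hd
  have hαs : 0 < 2 * α * (κ - 1) := by positivity
  unfold widthBound bias at hF
  set X : ℝ := Real.log (n / δ) / (c₁ d α κ c * n) with hX
  have hXpos : 0 < X := by positivity
  set A : ℝ := 2 * α * (κ - 1) + d - 1 with hA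
  have hA1 : 1 ≤ A := by linarith
  set q : ℝ := (⌈α⌉₊ : ℝ) ^ (d * ⌈α⌉₊) with hq
  have hqpos : 0 < q := by positivity
  set z : ℝ := (2 : ℝ) ^ F with hz
  have hzpos : 0 < z := by positivity
  have hgrid : (gridSize α F : ℝ) ^ (-α) ≤ z ^ (-α) := by
    refine Real.rpow_le_rpow_of_nonpos hzpos ?_ (by linarith)
    rw [gridSize]; push_cast
    exact le_mul_of_one_le_left hzpos.le hm
  have h1 : 7 * 2 ^ α * lam ^ (((d : ℝ) - 1) / A) * X ^ (α / A) < 6 * lam * z ^ (-α) := by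
    have h2 : 7 * q * 2 ^ α * lam ^ (((d : ℝ) - 1) / A) * X ^ (α / A)
        < 6 * (lam * q * z ^ (-α)) := hF.trans_le (by gcongr)
    have h3 : q * (7 * 2 ^ α * lam ^ (((d : ℝ) - 1) / A) * X ^ (α / A))
        < q * (6 * lam * z ^ (-α)) := by
      calc _ = 7 * q * 2 ^ α * lam ^ (((d : ℝ) - 1) / A) * X ^ (α / A) := by ring
        _ < _ := h2
        _ = _ := by ring
    exact lt_of_mul_lt_mul_left h3 hqpos.le
  -- The factor `2 ^ α` of the width bound turns `2 ^ F` into `2 ^ (F + 1)`, and its `7` against the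
  -- `6` leaves the slack `6/7`. Raising to the power `A / α` then isolates `X`.
  have hbase : X ^ (α / A) * ((2 * z) ^ α * lam ^ (((d : ℝ) - 1) / A - 1)) ≤ 6 / 7 := by
    rw [Real.rpow_neg hzpos.le, ← div_eq_mul_inv, lt_div_iff₀ (by positivity)] at h1
    rw [Real.rpow_sub_one hlam0.ne', Real.mul_rpow (by norm_num) hzpos.le, ← mul_div_assoc,
      ← mul_div_assoc, div_le_div_iff₀ hlam0 (by norm_num)]
    linarith
  have hpow := Real.rpow_le_rpow (by positivity) hbase (show 0 ≤ A / α by positivity)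
  rw [Real.mul_rpow (by positivity) (by positivity), Real.mul_rpow (by positivity) (by positivity),
    ← Real.rpow_mul hXpos.le, ← Real.rpow_mul (by positivity), ← Real.rpow_mul hlam0.le] at hpow
  have e1 : α / A * (A / α) = 1 := by field_simp
  have e2 : α * (A / α) = A := by field_simp
  have e3 : (((d : ℝ) - 1) / A - 1) * (A / α) = -(2 * (κ - 1)) := by
    have hA0 : A ≠ 0 := by linarith
    rw [sub_mul, div_mul_div_cancel₀ hA0, one_mul, ← sub_div, hA]
    field_simp
    ring
  rw [e1, e2, e3, Real.rpow_one] at hpow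
  rw [pow_succ, mul_comm ((2 : ℝ) ^ F) 2]
  refine hpow.trans ?_
  exact Real.rpow_le_rpow_of_exponent_ge (by norm_num) (by norm_num) (by gcongr)

/-- The depth sum is geometric with ratio `2 ^ A ≥ 2`, so depth `F + 1` dominates. The constant
`18.9` is `12.6 * 0.75 * 2`. The slack `(6/7) ^ (1/α)` compensates the logarithmic factor `3 + 2 α`
as `α` tends to `0`, through `mul_rpow_le`. In the end `18.9 * 8.6 < 400 (log 2) ^ 2`. -/
theorem totalCost_lt {d : ℕ} (hd : 2 ≤ d) {n : ℕ} (hn : 1 ≤ n) {δ lam α κ c : ℝ}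
    (hδ : 0 < δ) (hδ1 : δ ≤ 1 / 2) (hlam : 1 ≤ lam) (hα : 0 < α) (hκ : 1 < κ) (hc : 0 < c)
    (hc' : c ≤ 1 / 2) {F : ℕ} (hF : widthBound d n δ lam α κ c < 6 * bias d lam α F) :
    ∑ l ∈ Finset.range (F + 1), (gridSize α (l + 1) + 1) ^ (d - 1) *
      lineCost κ c ((3 + 2 * α) * Real.log (n / δ)) (numEpochs (precision lam α (l + 1))) < n := by
  have hδ1' : δ < 1 := by linarith
  have hX := two_pow_rpow_mul_le hd hn hδ hδ1' hlam hα hκ hc hc' hF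
  have hn1 : (1 : ℝ) ≤ n := by exact_mod_cast hn
  have hn' : (0 : ℝ) < n := by linarith
  have hp : (0 : ℝ) < ⌈α⌉₊ := by exact_mod_cast Nat.ceil_pos.2 hα
  have hlam0 : 0 < lam := by linarith
  have hs : 0 < κ - 1 := by linarith
  have hd' : (2 : ℝ) ≤ d := by exact_mod_cast hd
  have hαs : 0 < 2 * α * (κ - 1) := by positivity
  have hlog2 : 0.6931 < Real.log 2 := by linarith [Real.log_two_gt_d9]
  have hlogc : Real.log 2 ≤ Real.log (1 / c) :=
    Real.log_le_log (by norm_num) (by rw [le_div_iff₀ hc]; linarith)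
  have hlogn : Real.log 2 ≤ Real.log (n / δ) :=
    Real.log_le_log (by norm_num) (by rw [le_div_iff₀ hδ]; linarith)
  have hlog2pos : 0 < Real.log 2 := by linarith
  have hℓpos : 0 < Real.log (n / δ) := hlog2pos.trans_le hlogn
  set ℓ : ℝ := Real.log (n / δ) with hℓ
  set Λ : ℝ := (3 + 2 * α) * ℓ with hΛdef
  have hΛ : 1 ≤ Λ := by nlinarith
  set A : ℝ := 2 * α * (κ - 1) + d - 1 with hA
  have hA1 : 1 ≤ A := by linarith
  set E : ℝ := (8 : ℝ) ^ (2 * (κ - 1)) with hE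
  have hEpos : 0 < E := by positivity
  set D : ℝ := (2 * (⌈α⌉₊ : ℝ)) ^ (d - 1) with hD
  have hDpos : 0 < D := by positivity
  set Q : ℝ := D * E / (c ^ 2 * (κ - 1)) with hQ
  have hQpos : 0 < Q := by positivity
  set Z : ℝ := ((2 : ℝ) ^ (F + 1)) ^ A * lam ^ (-(2 * (κ - 1))) with hZ
  have hZpos : 0 < Z := by positivity
  have hXeq : ℓ / (c₁ d α κ c * n) = 400 * ℓ * Q * α * Real.log (1 / c) * κ / n := by
    rw [c₁, ← hE, ← hD, hQ]
    field_simp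
  rw [hXeq, div_mul_eq_mul_div, div_le_iff₀ hn'] at hX
  have hbound : ((∑ l ∈ Finset.range (F + 1), (gridSize α (l + 1) + 1) ^ (d - 1) *
      lineCost κ c Λ (numEpochs (precision lam α (l + 1))) : ℕ) : ℝ)
      ≤ 18.9 / Real.log 2 * Λ * Q * Z := by
    push_cast
    have hpowA : ∀ l : ℕ, ((2 : ℝ) ^ l) ^ A
        = ((2 : ℝ) ^ l) ^ (d - 1) * ((2 : ℝ) ^ l) ^ (2 * α * (κ - 1)) := by
      intro l
      rw [← Real.rpow_natCast ((2 : ℝ) ^ l) (d - 1), ← Real.rpow_add (by positivity)]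
      congr 1
      rw [Nat.cast_sub (by omega)]
      push_cast; rw [hA]; ring
    have hgeo : ∑ l ∈ Finset.range (F + 1), ((2 : ℝ) ^ (l + 1)) ^ A
        ≤ 2 * ((2 : ℝ) ^ (F + 1)) ^ A := by
      have e : ∀ l : ℕ, ((2 : ℝ) ^ l) ^ A = ((2 : ℝ) ^ A) ^ l := by
        intro l
        rw [← Real.rpow_natCast, ← Real.rpow_natCast, ← Real.rpow_mul (by norm_num),
          ← Real.rpow_mul (by norm_num), mul_comm]
      simp only [e]
      refine sum_range_pow_succ_le ?_ _
      calc (2 : ℝ) = 2 ^ (1 : ℝ) := by norm_num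
        _ ≤ 2 ^ A := Real.rpow_le_rpow_of_exponent_le (by norm_num) hA1
    calc _ ≤ ∑ l ∈ Finset.range (F + 1),
          (9.45 / Real.log 2 * Λ * Q * lam ^ (-(2 * (κ - 1)))) * ((2 : ℝ) ^ (l + 1)) ^ A := by
          refine Finset.sum_le_sum fun l _ => ?_
          refine (mul_le_mul (gridSize_add_one_pow_le hd hα (Nat.succ_pos l))
            (lineCost_le hκ hc hc' hΛ hlam0 (l + 1)) (Nat.cast_nonneg _)
            (by positivity)).trans (le_of_eq ?_)
          rw [hpowA, ← hE, ← hD, hQ]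
          simp only [Nat.succ_eq_add_one]
          ring
      _ ≤ (9.45 / Real.log 2 * Λ * Q * lam ^ (-(2 * (κ - 1)))) *
            (2 * ((2 : ℝ) ^ (F + 1)) ^ A) := by
          rw [← Finset.mul_sum]
          exact mul_le_mul_of_nonneg_left hgeo (by positivity)
      _ = _ := by rw [hZ]; ring
  have hu := mul_rpow_le (1 / α) (by positivity)
  have hYpos : 0 < ℓ * Q * Z := by positivity
  have hmain : (3 + 2 * α) * (ℓ * Q * Z) * (400 * (Real.log 2)) ≤ 8.6 * n := by
    have h1 : (3 + 2 * α) * (ℓ * Q * Z) * (400 * Real.log 2)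
        ≤ (3 * (1 / α) + 2) * (400 * ℓ * Q * α * Real.log (1 / c) * κ * Z) := by
      have e : (3 * (1 / α) + 2) * (400 * ℓ * Q * α * Real.log (1 / c) * κ * Z)
          = (3 + 2 * α) * (ℓ * Q * Z) * (400 * (Real.log (1 / c) * κ)) := by
        field_simp
      rw [e]
      gcongr
      nlinarith
    calc _ ≤ _ := h1
      _ ≤ (3 * (1 / α) + 2) * ((6 / 7 : ℝ) ^ (1 / α) * n) := by gcongr
      _ = ((3 * (1 / α) + 2) * (6 / 7 : ℝ) ^ (1 / α)) * n := by ring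
      _ ≤ 8.6 * n := by gcongr
  have hfin : 18.9 / Real.log 2 * Λ * Q * Z < n := by
    have e : 18.9 / Real.log 2 * Λ * Q * Z = 18.9 * ((3 + 2 * α) * (ℓ * Q * Z)) / Real.log 2 := by
      rw [hΛdef]; ring
    rw [e, div_lt_iff₀ (by linarith)]
    have hsq : 0.48 < Real.log 2 * Real.log 2 := by nlinarith
    have h2 := mul_lt_mul_of_pos_left hsq hn'
    refine lt_of_mul_lt_mul_right (a := 400 * Real.log 2) ?_ (by positivity)
    generalize (3 + 2 * α) * (ℓ * Q * Z) = G at hmain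
    linarith
  exact_mod_cast hbound.trans_lt hfin

/-- Within the budget, the logarithm in the confidence term is at most `(3 + 2 α) log (n / δ)`. -/
theorem two_mul_conf_le_epochGap {d : ℕ} (hd : 2 ≤ d) {n : ℕ} (hn : 1 ≤ n) {δ lam α κ c : ℝ}
    (hδ : 0 < δ) (hδ1 : δ ≤ 1 / 2) (hlam : 1 ≤ lam) (hα : 0 < α) (hc : 0 < c)
    {l k : ℕ} (hk : k < numEpochs (precision lam α l))
    (hcost : (gridSize α l + 1) ^ (d - 1) *
      lineCost κ c ((3 + 2 * α) * Real.log (n / δ)) (numEpochs (precision lam α l)) ≤ n) :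
    2 * conf (levelConf d δ α l / (numEpochs (precision lam α l) * 2 ^ (k + 1)))
      (epochRounds κ c ((3 + 2 * α) * Real.log (n / δ)) k) ≤ epochGap κ c k := by
  have hn1 : (1 : ℝ) ≤ n := by exact_mod_cast hn
  have hlog2 : 0.6931 < Real.log 2 := by linarith [Real.log_two_gt_d9]
  have hlogn : Real.log 2 ≤ Real.log (n / δ) :=
    Real.log_le_log (by norm_num) (by rw [le_div_iff₀ hδ]; linarith)
  set Λ : ℝ := (3 + 2 * α) * Real.log (n / δ) with hΛdef
  have hΛ : 1 ≤ Λ := by nlinarith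
  have hKpos : 0 < numEpochs (precision lam α l) := by omega
  have hK2 := two_pow_numEpochs_precision_lt (by linarith) hKpos
  set K := numEpochs (precision lam α l) with hKdef
  set τ := epochRounds κ c Λ k with hτ
  have hτ1 : 1 ≤ τ := one_le_epochRounds hc hΛ k
  have hτ1' : (1 : ℝ) ≤ τ := by exact_mod_cast hτ1
  have hm : (1 : ℝ) ≤ cellNodes α := by exact_mod_cast one_le_cellNodes α
  obtain ⟨M, hM⟩ : ∃ M : ℝ, M = cellNodes α * 2 ^ l := ⟨_, rfl⟩
  have hx1 : (1 : ℝ) ≤ 2 ^ l := one_le_pow₀ (by norm_num)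
  have hxM : (2 : ℝ) ^ l ≤ M := by rw [hM]; exact le_mul_of_one_le_left (by positivity) hm
  have hM1 : 1 ≤ M := hx1.trans hxM
  have hτle : 3 * τ ≤ lineCost κ c Λ K :=
    Finset.single_le_sum (f := fun k => 3 * epochRounds κ c Λ k) (fun _ _ => Nat.zero_le _)
      (Finset.mem_range.2 hk)
  -- A single epoch on every line of the grid already fits in the budget; this bounds `M` and `τ`
  -- jointly, which keeps `d` out of the logarithm.
  have hMτ : M ^ (d - 1) * τ ≤ n := by
    have h1 : gridSize α l ^ (d - 1) * τ ≤ n := by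
      refine le_trans (Nat.mul_le_mul (Nat.pow_le_pow_left (Nat.le_succ _) _) ?_) hcost
      omega
    have h2 : M = ((gridSize α l : ℕ) : ℝ) := by rw [hM, gridSize]; push_cast; rfl
    rw [h2]
    exact_mod_cast h1
  have hMn : M ≤ n := by
    calc M = M ^ 1 * 1 := by ring
      _ ≤ M ^ (d - 1) * τ := by
        gcongr
        omega
      _ ≤ n := hMτ
  have hK1 : (1 : ℝ) ≤ K := by exact_mod_cast hKpos
  have hKK : (K : ℝ) * 2 ^ K ≤ (n : ℝ) ^ (2 * α) := by
    have h1 : (K : ℝ) ≤ 2 ^ K := by exact_mod_cast Nat.lt_two_pow_self.le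
    have h2 : (2 : ℝ) ^ K ≤ (n : ℝ) ^ α := by
      calc (2 : ℝ) ^ K ≤ 2 ^ K * lam := le_mul_of_one_le_right (by positivity) hlam
        _ ≤ ((2 : ℝ) ^ l) ^ α := hK2.le
        _ ≤ (n : ℝ) ^ α := Real.rpow_le_rpow (by positivity) (hxM.trans hMn) hα.le
    calc (K : ℝ) * 2 ^ K ≤ (n : ℝ) ^ α * (n : ℝ) ^ α :=
          mul_le_mul (h1.trans h2) h2 (by positivity) (by positivity)
      _ = (n : ℝ) ^ (2 * α) := by rw [← Real.rpow_add (by linarith)]; congr 1; ring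
  set δ' := levelConf d δ α l / (K * 2 ^ (k + 1)) with hδ'
  have hlc := levelConf_pos d hδ α l
  have hδ'pos : 0 < δ' := by positivity
  -- The factor `m ^ d` in `levelConf` completes `m 2 ^ (l (d + 1))` to `M ^ (d + 1)`.
  have hδ'ge : δ / (M ^ (d + 1) * (K * 2 ^ K)) ≤ δ' := by
    have h1 := le_levelConf d hδ α l
    have h2 : depthConf d δ α l / (cellNodes α : ℝ) ^ d = δ / M ^ (d + 1) := by
      rw [depthConf, div_div, hM, mul_pow, ← pow_mul, pow_succ (cellNodes α : ℝ)]
      congr 1; ring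
    rw [h2] at h1
    rw [← div_div]
    have h3 : (2 : ℝ) ^ (k + 1) ≤ 2 ^ K := pow_le_pow_right₀ (by norm_num) hk
    rw [hδ']
    gcongr
  -- Of the exponent `3 + 2 α`, one unit comes from `M ^ (d - 1) τ`, two from `M ^ 2`, and `2 α`
  -- from `K 2 ^ K`.
  have hratio : (τ : ℝ) / δ' ≤ (n / δ) ^ (3 + 2 * α) := by
    have hn0 : (0 : ℝ) < n := by linarith
    have hMpos : 0 < M := by linarith
    calc (τ : ℝ) / δ' ≤ τ / (δ / (M ^ (d + 1) * (K * 2 ^ K))) := by gcongr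
      _ = (M ^ (d - 1) * τ) * M ^ 2 * (K * 2 ^ K) / δ := by
        have : M ^ (d + 1) = M ^ (d - 1) * M ^ 2 := by rw [← pow_add]; congr 1; omega
        rw [this, div_div_eq_mul_div]; ring
      _ ≤ n * (n : ℝ) ^ 2 * (n : ℝ) ^ (2 * α) / δ := by gcongr
      _ = (n : ℝ) ^ (3 + 2 * α) / δ := by
        rw [Real.rpow_add hn0, show (3 : ℝ) = ((3 : ℕ) : ℝ) by norm_num, Real.rpow_natCast]
        ring
      _ ≤ (n : ℝ) ^ (3 + 2 * α) / δ ^ (3 + 2 * α) := by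
        gcongr
        calc δ ^ (3 + 2 * α) ≤ δ ^ (1 : ℝ) :=
              Real.rpow_le_rpow_of_exponent_ge hδ (by linarith) (by linarith)
          _ = δ := Real.rpow_one δ
      _ = _ := (Real.div_rpow hn0.le hδ.le _).symm
  have hlog : Real.log (τ / δ') ≤ Λ := by
    calc Real.log (τ / δ') ≤ Real.log ((n / δ) ^ (3 + 2 * α)) :=
          Real.log_le_log (by positivity) hratio
      _ = Λ := Real.log_rpow (by positivity) _
  have hg := epochGap_pos (κ := κ) hc k
  have hτge : 8 * Λ / epochGap κ c k ^ 2 ≤ τ := Nat.le_ceil _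
  have hsqrt : Real.sqrt (Real.log (τ / δ') / (2 * τ)) ≤ epochGap κ c k / 4 := by
    rw [Real.sqrt_le_iff]
    refine ⟨by positivity, ?_⟩
    rw [div_le_iff₀ (by positivity)] at hτge
    rw [div_le_iff₀ (by positivity)]
    nlinarith
  rw [conf]
  linarith

/-! ### The bias term -/

theorem bias_eq (d : ℕ) (lam α : ℝ) (l : ℕ) : bias d lam α l =
    lam * (⌈α⌉₊ : ℝ) ^ (d * ⌈α⌉₊) / ((cellNodes α : ℝ) * 2 ^ l) ^ α := by
  rw [bias, Real.rpow_neg (Nat.cast_nonneg _), gridSize, div_eq_mul_inv]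
  push_cast; rfl

theorem bias_pos (d : ℕ) {lam α : ℝ} (hlam : 0 < lam) (hα : 0 < α) (l : ℕ) :
    0 < bias d lam α l := by
  have hp : (0 : ℝ) < ⌈α⌉₊ := by exact_mod_cast Nat.ceil_pos.2 hα
  have hM : (0 : ℝ) < gridSize α l := by exact_mod_cast gridSize_pos α l
  unfold bias
  positivity

/-- The constant in the bias term pays for the Lebesgue constant and for the factor `m ^ α` between
`2 ^ (-l α)` and `M_l ^ (-α)`. -/
theorem two_pow_mul_cellNodes_rpow_le {d : ℕ} (hd : 1 ≤ d) {α : ℝ} (hα : 0 < α) :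
    (2 : ℝ) ^ (strictFloor α * (d - 1)) * (cellNodes α : ℝ) ^ α ≤ (⌈α⌉₊ : ℝ) ^ (d * ⌈α⌉₊) := by
  have hm : (1 : ℝ) ≤ cellNodes α := by exact_mod_cast one_le_cellNodes α
  have hmp : (cellNodes α : ℝ) ≤ ⌈α⌉₊ := by exact_mod_cast cellNodes_le_ceil hα
  have hp : (1 : ℝ) ≤ ⌈α⌉₊ := hm.trans hmp
  have h1 : (cellNodes α : ℝ) ^ α ≤ (⌈α⌉₊ : ℝ) ^ ⌈α⌉₊ := by
    calc (cellNodes α : ℝ) ^ α ≤ (⌈α⌉₊ : ℝ) ^ α := by gcongr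
      _ ≤ (⌈α⌉₊ : ℝ) ^ ((⌈α⌉₊ : ℕ) : ℝ) := Real.rpow_le_rpow_of_exponent_le hp (Nat.le_ceil α)
      _ = _ := Real.rpow_natCast _ _
  have h2 : (2 : ℝ) ^ (strictFloor α * (d - 1)) ≤ (⌈α⌉₊ : ℝ) ^ (⌈α⌉₊ * (d - 1)) := by
    rcases Nat.eq_zero_or_pos (strictFloor α) with h0 | hpos
    · rw [h0, zero_mul, pow_zero]; exact one_le_pow₀ hp
    · have h3 : 2 ≤ ⌈α⌉₊ := by rw [strictFloor] at hpos; omega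
      calc (2 : ℝ) ^ (strictFloor α * (d - 1)) ≤ (⌈α⌉₊ : ℝ) ^ (strictFloor α * (d - 1)) := by
            gcongr; exact_mod_cast h3
        _ ≤ _ := pow_le_pow_right₀ hp (Nat.mul_le_mul_right _ (Nat.sub_le _ _))
  calc _ ≤ (⌈α⌉₊ : ℝ) ^ (⌈α⌉₊ * (d - 1)) * (⌈α⌉₊ : ℝ) ^ ⌈α⌉₊ := by gcongr
    _ = _ := by
      rw [← pow_add]; congr 1
      obtain ⟨e, rfl⟩ := Nat.exists_eq_add_of_le' hd
      rw [Nat.add_sub_cancel]; ring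

theorem lebesgue_mul_precision_le_bias {d : ℕ} (hd : 1 ≤ d) {lam α : ℝ} (hlam : 0 < lam)
    (hα : 0 < α) (l : ℕ) :
    (2 : ℝ) ^ (strictFloor α * (d - 1)) * (precision lam α l + lam * (((2 : ℝ) ^ l)⁻¹) ^ α)
      ≤ 2 * bias d lam α l := by
  have hm : (0 : ℝ) < cellNodes α := by exact_mod_cast one_le_cellNodes α
  have h := two_pow_mul_cellNodes_rpow_le hd hα
  rw [precision_eq, bias_eq, Real.inv_rpow (by positivity), Real.mul_rpow hm.le (by positivity)]
  have hmα : (0 : ℝ) < (cellNodes α : ℝ) ^ α := by positivity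
  have hx : (0 : ℝ) < ((2 : ℝ) ^ l) ^ α := by positivity
  calc (2 : ℝ) ^ (strictFloor α * (d - 1)) *
        (lam * (((2 : ℝ) ^ l) ^ α)⁻¹ + lam * (((2 : ℝ) ^ l) ^ α)⁻¹)
      = 2 * (lam * ((2 : ℝ) ^ (strictFloor α * (d - 1)) * (cellNodes α : ℝ) ^ α) /
          ((cellNodes α : ℝ) ^ α * ((2 : ℝ) ^ l) ^ α)) := by field_simp; ring
    _ ≤ _ := by gcongr

/-- At such a depth `2 ^ (d - 1) M_l ≤ ⌈α⌉ ^ d`; the power `⌈α⌉` of this gives the claim. -/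
theorem lebesgue_le_bias {d : ℕ} (hd : 2 ≤ d) {lam α : ℝ} (hlam : 1 ≤ lam)
    (hα : 0 < α) {l : ℕ} (hl : 2 ^ (l + 1) ≤ ⌈α⌉₊) :
    (2 : ℝ) ^ (strictFloor α * (d - 1)) ≤ bias d lam α l := by
  obtain ⟨e, rfl⟩ := Nat.exists_eq_add_of_le' hd
  have hm : (1 : ℝ) ≤ cellNodes α := by exact_mod_cast one_le_cellNodes α
  have hx1 : (1 : ℝ) ≤ 2 ^ l := one_le_pow₀ (by norm_num)
  have h2p : 2 ≤ ⌈α⌉₊ := by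
    have : 2 ^ 1 ≤ 2 ^ (l + 1) := Nat.pow_le_pow_right (by norm_num) (by omega)
    omega
  have hnat : 2 ^ (e + 1) * (cellNodes α * 2 ^ l) ≤ ⌈α⌉₊ ^ (e + 2) := by
    calc 2 ^ (e + 1) * (cellNodes α * 2 ^ l) = 2 ^ e * (cellNodes α * 2 ^ (l + 1)) := by ring
      _ ≤ ⌈α⌉₊ ^ e * (⌈α⌉₊ * ⌈α⌉₊) :=
        Nat.mul_le_mul (Nat.pow_le_pow_left h2p e) (Nat.mul_le_mul (cellNodes_le_ceil hα) hl)
      _ = _ := by ring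
  have hreal : (2 : ℝ) ^ (e + 1) * (cellNodes α * 2 ^ l) ≤ (⌈α⌉₊ : ℝ) ^ (e + 2) := by
    exact_mod_cast hnat
  have hgrid1 : (1 : ℝ) ≤ cellNodes α * 2 ^ l := one_le_mul_of_one_le_of_one_le hm hx1
  have hexp : strictFloor α * (e + 2 - 1) ≤ (e + 1) * ⌈α⌉₊ := by
    rw [mul_comm]
    exact Nat.mul_le_mul_left _ (Nat.sub_le _ _)
  have hpow := pow_le_pow_right₀ (one_le_two (α := ℝ)) hexp
  have hrpow := Real.rpow_le_rpow_of_exponent_le hgrid1 (Nat.le_ceil α)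
  rw [bias_eq, le_div_iff₀ (by positivity)]
  calc (2 : ℝ) ^ (strictFloor α * (e + 2 - 1)) * ((cellNodes α : ℝ) * 2 ^ l) ^ α
      ≤ (2 : ℝ) ^ ((e + 1) * ⌈α⌉₊) * ((cellNodes α : ℝ) * 2 ^ l) ^ ((⌈α⌉₊ : ℕ) : ℝ) :=
        mul_le_mul hpow hrpow (by positivity) (by positivity)
    _ = ((2 : ℝ) ^ (e + 1) * (cellNodes α * 2 ^ l)) ^ ⌈α⌉₊ := by
        rw [Real.rpow_natCast, pow_mul, ← mul_pow]
    _ ≤ ((⌈α⌉₊ : ℝ) ^ (e + 2)) ^ ⌈α⌉₊ := by gcongr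
    _ = 1 * (⌈α⌉₊ : ℝ) ^ ((e + 2) * ⌈α⌉₊) := by rw [one_mul, pow_mul]
    _ ≤ _ := by gcongr

/-! ### Correctness on the favourable event -/

section Correctness

variable {d : ℕ} {lam α κ c δ : ℝ} {n : ℕ} {P : ClassificationProblem d}
  {g : (Fin (d - 1) → ℝ) → ℝ} {y : Request d → Point d → Bool}

theorem half_le_eta_iff (hP : InClass P lam α κ c g) {x : Fin (d - 1) → ℝ} (hx : x ∈ baseCube d) :
    ∀ z ∈ Set.Icc (0 : ℝ) 1, (1 / 2 ≤ P.eta (x, z) ↔ g x ≤ z) := by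
  intro z hz
  have hmem : (x, z) ∈ cube d := ⟨hx, hz⟩
  have h := Set.ext_iff.1 hP.epigraph (x, z)
  simpa [hmem] using h

theorem epochGap_le_abs_eta_sub (hκ : 1 ≤ κ) (hc : 0 < c) (hP : InClass P lam α κ c g)
    {x : Fin (d - 1) → ℝ} (hx : x ∈ baseCube d) (k : ℕ) :
    ∀ z ∈ Set.Icc (0 : ℝ) 1, ((2 : ℝ) ^ k)⁻¹ / 8 ≤ |z - g x| →
      epochGap κ c k ≤ |P.eta (x, z) - 1 / 2| := by
  intro z hz hd
  refine le_trans ?_ (hP.noise (x, z) ⟨hx, hz⟩)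
  unfold epochGap
  gcongr

/-- Accuracy of the interpolant at the last completed depth, if this depth is not so small that
nothing is returned. -/
theorem abs_interpolant_thresholds_sub_le (hd : 2 ≤ d) (hlam : 1 ≤ lam) (hα : 0 < α)
    (hP : InClass P lam α κ c g) (hy : AllDeviation P δ lam α y)
    (hF : 1 ≤ finalDepth y n δ lam α) (hhigh : ¬ 2 ^ (finalDepth y n δ lam α + 1) ≤ ⌈α⌉₊)
    {x : Fin (d - 1) → ℝ} (hx : x ∈ baseCube d) :
    |interpolant α (finalDepth y n δ lam α) (thresholds y n δ lam α) x - g x|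
      ≤ 2 * bias d lam α (finalDepth y n δ lam α) := by
  have hlam0 : 0 < lam := by linarith
  have hT := mainLoop_finalDepth_eq y n δ hlam0 hα
  set F := finalDepth y n δ lam α
  have hε : 0 < precision lam α F := by rw [precision_eq]; positivity
  refine (abs_interpolant_sub_le (ε := precision lam α F) hlam0.le hα F hP.holder
    (fun a ha => ?_) hx).trans (lebesgue_mul_precision_le_bias (by omega) hlam0 hα F)
  obtain ⟨B, hB⟩ := exists_searchLine_of_mainLoop y n δ lam α hF hT ha
  have hgp := gridPoint_mem_baseCube α F ha
  have hdev := hy F hF a ha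
  rw [levelConf, if_neg hhigh] at hdev
  exact abs_lineSearch_sub_le hε (half_le_eta_iff hP hgp) hdev (hP.holder.mapsTo hgp) hB

theorem abs_interpolant_thresholds_le (hlam : 1 ≤ lam) (hα : 0 < α)
    (hF : 1 ≤ finalDepth y n δ lam α) {x : Fin (d - 1) → ℝ} (hx : x ∈ baseCube d) :
    |interpolant α (finalDepth y n δ lam α) (thresholds y n δ lam α) x|
      ≤ (2 : ℝ) ^ (strictFloor α * (d - 1)) := by
  have hT := mainLoop_finalDepth_eq y n δ (by linarith : 0 < lam) hα
  refine abs_interpolant_le α _ (fun a ha => ?_) hx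
  obtain ⟨B, hB⟩ := exists_searchLine_of_mainLoop y n δ lam α hF hT ha
  obtain ⟨h0, h1⟩ := lineSearch_mem hB
  rw [abs_of_nonneg h0]; exact h1

/-- At shallow depths `|P̂| ≤ b` and `g* ≤ 1 ≤ b` already give the bound; elsewhere the accuracy `2
b` does. -/
theorem abs_interpolant_thresholds_sub_lt (hd : 2 ≤ d) (hlam : 1 ≤ lam) (hα : 0 < α)
    (hP : InClass P lam α κ c g) (hy : AllDeviation P δ lam α y)
    (hF : 1 ≤ finalDepth y n δ lam α) {x : Fin (d - 1) → ℝ} (hx : x ∈ baseCube d) :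
    |interpolant α (finalDepth y n δ lam α) (thresholds y n δ lam α) x - g x|
      < 4 * bias d lam α (finalDepth y n δ lam α) := by
  have hb := bias_pos d (by linarith : 0 < lam) hα (finalDepth y n δ lam α)
  by_cases hlow : 2 ^ (finalDepth y n δ lam α + 1) ≤ ⌈α⌉₊
  · have h1 := abs_interpolant_thresholds_le hlam hα hF hx
    have h2 := lebesgue_le_bias hd hlam hα hlow
    have h3 : (1 : ℝ) ≤ (2 : ℝ) ^ (strictFloor α * (d - 1)) := one_le_pow₀ (by norm_num)
    obtain ⟨h4, h5⟩ := hP.holder.mapsTo hx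
    rw [abs_le] at h1
    rw [abs_lt]; constructor <;> linarith
  · have h1 := abs_interpolant_thresholds_sub_le hd hlam hα hP hy hF hlow hx
    linarith

theorem outputOne_subset (hd : 2 ≤ d) (hlam : 1 ≤ lam) (hα : 0 < α)
    (hP : InClass P lam α κ c g) (hy : AllDeviation P δ lam α y) :
    outputOne y n δ lam α ⊆ {x ∈ cube d | g x.1 < x.2} := by
  rintro x ⟨hx, hF, h⟩
  have h1 := abs_lt.1 (abs_interpolant_thresholds_sub_lt hd hlam hα hP hy hF hx.1)
  exact ⟨hx, by linarith [h1.1]⟩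

theorem outputZero_subset (hd : 2 ≤ d) (hlam : 1 ≤ lam) (hα : 0 < α)
    (hP : InClass P lam α κ c g) (hy : AllDeviation P δ lam α y) :
    outputZero y n δ lam α ⊆ {x ∈ cube d | x.2 < g x.1} := by
  rintro x ⟨hx, hF, h⟩
  have h1 := abs_lt.1 (abs_interpolant_thresholds_sub_lt hd hlam hα hP hy hF hx.1)
  exact ⟨hx, by linarith [h1.2]⟩

/-- The last completed depth is large enough for the width bound. -/
theorem six_mul_bias_le_widthBound (hd : 2 ≤ d) (hlam : 1 ≤ lam) (hα : 0 < α) (hκ : 1 < κ)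
    (hc : 0 < c) (hc' : c ≤ 1 / 2) (hn : 1 ≤ n) (hδ : 0 < δ) (hδ1 : δ ≤ 1 / 2)
    (hP : InClass P lam α κ c g) (hy : AllDeviation P δ lam α y) :
    6 * bias d lam α (finalDepth y n δ lam α) ≤ widthBound d n δ lam α κ c := by
  by_contra hcon
  push Not at hcon
  have hlam0 : 0 < lam := by linarith
  set F := finalDepth y n δ lam α with hFdef
  have hcost := totalCost_lt hd hn hδ hδ1 hlam hα hκ hc hc' hcon
  set Λ : ℝ := (3 + 2 * α) * Real.log (n / δ) with hΛdef
  have hΛ : 1 ≤ Λ := by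
    have hn1 : (1 : ℝ) ≤ n := by exact_mod_cast hn
    have hlog2 : 0.6931 < Real.log 2 := by linarith [Real.log_two_gt_d9]
    have hlogn : Real.log 2 ≤ Real.log (n / δ) :=
      Real.log_le_log (by norm_num) (by rw [le_div_iff₀ hδ]; linarith)
    nlinarith
  -- Depth `F + 1` would also be completed, against the maximality of `F`.
  have hdone := mainLoop_terminates y n δ lam α (L := F + 1)
    (C := fun l => lineCost κ c Λ (numEpochs (precision lam α l)))
    (fun l hl hlF a ha B hB => ?_) hcost le_rfl
  · have := le_finalDepth y n δ hlam0 hα hdone.1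
    omega
  · have hgp := gridPoint_mem_baseCube α l ha
    have hle : (gridSize α l + 1) ^ (d - 1) *
        lineCost κ c Λ (numEpochs (precision lam α l)) ≤ n := by
      obtain ⟨i, rfl⟩ := Nat.exists_eq_add_of_le' hl
      refine le_trans ?_ hcost.le
      exact Finset.single_le_sum (f := fun l => (gridSize α (l + 1) + 1) ^ (d - 1) *
        lineCost κ c Λ (numEpochs (precision lam α (l + 1)))) (fun _ _ => Nat.zero_le _)
        (Finset.mem_range.2 (by omega))
    exact lineSearch_terminates (levelConf_pos d hδ α l) (levelConf_le_depthConf d hδ α l)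
      (half_le_eta_iff hP hgp) (fun k _ => epochGap_le_abs_eta_sub hκ.le hc hP hgp k)
      (fun k _ => one_le_epochRounds hc hΛ k) hB
      (fun k hk => two_mul_conf_le_epochGap hd hn hδ hδ1 hlam hα hc hk hle) (hy l hl a ha)

/-- If no depth is completed, `finalDepth` is `0`; this lower bound excludes that case when the
width bound is below `1`. -/
theorem one_le_bias_zero (hd : 1 ≤ d) (hlam : 1 ≤ lam) (hα : 0 < α) : 1 ≤ bias d lam α 0 := by
  have hm : (1 : ℝ) ≤ cellNodes α := by exact_mod_cast one_le_cellNodes α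
  have h := two_pow_mul_cellNodes_rpow_le hd hα
  have h3 : (1 : ℝ) ≤ (2 : ℝ) ^ (strictFloor α * (d - 1)) := one_le_pow₀ (by norm_num)
  have hmα : (0 : ℝ) < (cellNodes α : ℝ) ^ α := by positivity
  rw [bias_eq, pow_zero, mul_one, le_div_iff₀ hmα, one_mul]
  calc (cellNodes α : ℝ) ^ α ≤ (2 : ℝ) ^ (strictFloor α * (d - 1)) * (cellNodes α : ℝ) ^ α :=
        le_mul_of_one_le_left hmα.le h3
    _ ≤ (⌈α⌉₊ : ℝ) ^ (d * ⌈α⌉₊) := h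
    _ ≤ _ := le_mul_of_one_le_left (by positivity) hlam

/-- A width bound below `1` forces `b < 1`, which excludes depth `0` and the shallow depths. The
interpolation error `2 b` and the margin `4 b` then add up to `6 b`. -/
theorem subset_outputs (hd : 2 ≤ d) (hlam : 1 ≤ lam) (hα : 0 < α) (hκ : 1 < κ)
    (hc : 0 < c) (hc' : c ≤ 1 / 2) (hn : 1 ≤ n) (hδ : 0 < δ) (hδ1 : δ ≤ 1 / 2)
    (hP : InClass P lam α κ c g) (hy : AllDeviation P δ lam α y)
    (hW : widthBound d n δ lam α κ c < 1) :
    {x ∈ cube d | widthBound d n δ lam α κ c < x.2 - g x.1} ⊆ outputOne y n δ lam α ∧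
    {x ∈ cube d | widthBound d n δ lam α κ c < g x.1 - x.2} ⊆ outputZero y n δ lam α := by
  have h6 := six_mul_bias_le_widthBound hd hlam hα hκ hc hc' hn hδ hδ1 hP hy
  have hF : 1 ≤ finalDepth y n δ lam α := by
    by_contra h0
    have h0' : finalDepth y n δ lam α = 0 := by omega
    rw [h0'] at h6
    have := one_le_bias_zero (d := d) (by omega) hlam hα
    linarith
  have hhigh : ¬ 2 ^ (finalDepth y n δ lam α + 1) ≤ ⌈α⌉₊ := by
    intro hlow
    have h2 := lebesgue_le_bias hd hlam hα hlow
    have h3 : (1 : ℝ) ≤ (2 : ℝ) ^ (strictFloor α * (d - 1)) := one_le_pow₀ (by norm_num)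
    linarith
  constructor
  · rintro x ⟨hx, h⟩
    have h1 := abs_le.1 (abs_interpolant_thresholds_sub_le hd hlam hα hP hy hF hhigh hx.1)
    exact ⟨hx, hF, by linarith [h1.2]⟩
  · rintro x ⟨hx, h⟩
    have h1 := abs_le.1 (abs_interpolant_thresholds_sub_le hd hlam hα hP hy hF hhigh hx.1)
    exact ⟨hx, hF, by linarith [h1.1]⟩

theorem measurableSet_cube (d : ℕ) : MeasurableSet (cube d) :=
  (measurableSet_Icc (a := (0 : Fin (d - 1) → ℝ)) (b := 1)).prod measurableSet_Icc

theorem measurableSet_outputZero (y : Request d → Point d → Bool) (n : ℕ) (δ lam α : ℝ) :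
    MeasurableSet (outputZero y n δ lam α) := by
  unfold outputZero
  refine (measurableSet_cube d).inter ((MeasurableSet.const _).inter ?_)
  exact measurableSet_le measurable_snd
    (((measurable_interpolant α _ _).comp measurable_fst).sub_const _)

theorem measurableSet_outputOne (y : Request d → Point d → Bool) (n : ℕ) (δ lam α : ℝ) :
    MeasurableSet (outputOne y n δ lam α) := by
  unfold outputOne
  refine (measurableSet_cube d).inter ((MeasurableSet.const _).inter ?_)
  exact measurableSet_le (((measurable_interpolant α _ _).comp measurable_fst).add_const _)
    measurable_snd

theorem disjoint_outputs (hlam : 0 < lam) (hα : 0 < α) :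
    Disjoint (outputZero y n δ lam α) (outputOne y n δ lam α) := by
  rw [Set.disjoint_left]
  rintro x ⟨-, -, h1⟩ ⟨-, -, h2⟩
  have := bias_pos d hlam hα (finalDepth y n δ lam α)
  linarith

theorem isCorrect_of_prob {Ω : Type*} [MeasurableSpace Ω] {μ : Measure Ω}
    {Y : Request d → Point d → Ω → Bool} (hlam : 0 < lam) (hα : 0 < α) {Δ : ℝ} (hΔ : 0 ≤ Δ)
    (h : μ {ω | ¬ (labelsRequested (fun r x => Y r x ω) n δ lam α ≤ n ∧
      {x ∈ cube d | Δ < x.2 - g x.1} ⊆ outputOne (fun r x => Y r x ω) n δ lam α ∧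
      {x ∈ cube d | Δ < g x.1 - x.2} ⊆ outputZero (fun r x => Y r x ω) n δ lam α ∧
      outputOne (fun r x => Y r x ω) n δ lam α ⊆ {x ∈ cube d | g x.1 < x.2} ∧
      outputZero (fun r x => Y r x ω) n δ lam α ⊆ {x ∈ cube d | x.2 < g x.1})}
        < ENNReal.ofReal (2 * δ)) :
    IsCorrect μ
        (fun ω => outputZero (fun r x => Y r x ω) n δ lam α)
        (fun ω => outputOne (fun r x => Y r x ω) n δ lam α)
        (fun ω => labelsRequested (fun r x => Y r x ω) n δ lam α)
        g δ Δ n where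
  nonneg := hΔ
  subset_zero _ := fun _ hx => hx.1
  subset_one _ := fun _ hx => hx.1
  disjoint _ := disjoint_outputs hlam hα
  measurable_zero _ := measurableSet_outputZero _ _ _ _ _
  measurable_one _ := measurableSet_outputOne _ _ _ _ _
  prob := h

/-- The budget holds on every run and the absence of errors on the favourable event, so only
coverage remains. The exceptional probability is at most `δ`, strictly below `2 δ`. -/
theorem isCorrect_of_subset_outputs (hd : 2 ≤ d) (hlam : 1 ≤ lam) (hα : 0 < α) (hδ : 0 < δ)
    (hδ1 : δ ≤ 1) (hP : InClass P lam α κ c g) {Ω : Type*} [MeasurableSpace Ω] {μ : Measure Ω}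
    [IsProbabilityMeasure μ] {Y : Request d → Point d → Ω → Bool} (hY : IsLabelOracle P μ Y)
    {Δ : ℝ} (hΔ : 0 ≤ Δ)
    (h : ∀ y : Request d → Point d → Bool, AllDeviation P δ lam α y →
      {x ∈ cube d | Δ < x.2 - g x.1} ⊆ outputOne y n δ lam α ∧
      {x ∈ cube d | Δ < g x.1 - x.2} ⊆ outputZero y n δ lam α) :
    IsCorrect μ
        (fun ω => outputZero (fun r x => Y r x ω) n δ lam α)
        (fun ω => outputOne (fun r x => Y r x ω) n δ lam α)
        (fun ω => labelsRequested (fun r x => Y r x ω) n δ lam α)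
        g δ Δ n := by
  refine isCorrect_of_prob (by linarith) hα hΔ ?_
  refine lt_of_le_of_lt (measure_mono fun ω hω => ?_)
    (lt_of_le_of_lt (measure_not_allDeviation_le (lam := lam) (by omega) hδ hδ1 hα hY)
      ((ENNReal.ofReal_lt_ofReal_iff (by linarith)).2 (by linarith)))
  intro hdev
  exact hω ⟨mainLoop_fst_le _ _ _ _ _ _, (h _ hdev).1, (h _ hdev).2,
    outputOne_subset hd hlam hα hP hdev, outputZero_subset hd hlam hα hP hdev⟩

end Correctness

end ActiveLearning

/-! ### The theorem -/

theorem theorem4 {d : ℕ} (hd : 2 ≤ d) {lam α κ c δ : ℝ} {n : ℕ}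
    (hlam : 1 ≤ lam) (hα : 0 < α) (hκ : 1 ≤ κ) (hc : 0 < c) (hc' : c ≤ 1 / 2)
    (hn : 1 ≤ n) (hδ : 0 < δ) (hδ' : δ < 1)
    (P : ClassificationProblem d) (g : (Fin (d - 1) → ℝ) → ℝ) (hP : InClass P lam α κ c g)
    {Ω : Type*} [MeasurableSpace Ω] (μ : MeasureTheory.Measure Ω)
    [MeasureTheory.IsProbabilityMeasure μ]
    (Y : Request d → Point d → Ω → Bool) (hY : IsLabelOracle P μ Y) :
    ∃ Δ : ℝ,
      IsCorrect μ
        (fun ω => outputZero (fun r x => Y r x ω) n δ lam α)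
        (fun ω => outputOne (fun r x => Y r x ω) n δ lam α)
        (fun ω => labelsRequested (fun r x => Y r x ω) n δ lam α)
        g δ Δ n ∧
      (1 < κ → Δ ≤ widthBound d n δ lam α κ c) := by
  by_cases hW : 1 < κ ∧ widthBound d n δ lam α κ c < 1
  · obtain ⟨hκ1, hW⟩ := hW
    have hW0 := widthBound_nonneg d hn hδ hδ' (by linarith : 0 < lam) hα hκ1 hc hc'
    refine ⟨widthBound d n δ lam α κ c, ?_, fun _ => le_rfl⟩
    rcases le_or_gt δ (1 / 2) with hδ2 | hδ2
    · exact isCorrect_of_subset_outputs hd hlam hα hδ hδ'.le hP hY hW0 fun y hy =>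
        subset_outputs hd hlam hα hκ1 hc hc' hn hδ hδ2 hP hy hW
    -- For `δ > 1/2` the allowed failure probability `2 δ` exceeds `1`. The cost estimate needs `δ ≤
    -- 1/2`, to have `log (n / δ) ≥ log 2`.
    · refine isCorrect_of_prob (by linarith) hα hW0 (lt_of_le_of_lt prob_le_one ?_)
      rw [← ENNReal.ofReal_one]
      exact (ENNReal.ofReal_lt_ofReal_iff (by linarith)).2 (by linarith)
  -- Both coverage conditions are void for `Δ = 1`, because `x_d` and `g*` lie in `[0, 1]`.
  · refine ⟨1, ?_, fun hκ1 => not_lt.1 fun h => hW ⟨hκ1, h⟩⟩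
    refine isCorrect_of_subset_outputs hd hlam hα hδ hδ'.le hP hY zero_le_one fun y _ => ?_
    constructor
    · rintro x ⟨hx, h⟩
      linarith [hx.2.2, (hP.holder.mapsTo hx.1).1]
    · rintro x ⟨hx, h⟩
      linarith [hx.2.1, (hP.holder.mapsTo hx.1).2]
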